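/- For $N\ge 1$ let $[N]=\{0,\dots,N-1\}$. Given $f:[N]\to\mathbb N\cup\{\infty\}$, $g:[N]\to\mathbb N$ (where $g(j)$ is called the *type* of $j$) and an integer $d'\ge 0$, let $e=|\{g(j):j\in[N]\}|$ and $d=\min\{d',e\}$. The problem **Find $d$ Smallest Values of Different Type** asks for a set $I\subseteq[N]$ with $|I|=d$ such that - $g(i)\ne g(i')$ for all distinct $i,i'\in I$, and - for all $j\in[N]\setminus I$ and $i\in I$ with $f(j)<f(i)$ there is $i'\in I$ with $g(i')=g(j)$ and $f(i')\le f(j)$. The functions are given by a quantum black box; one query is the unitary $|j\rangle|a,b\rangle|w\rangle\mapsto|j\rangle|a\oplus f(j),\,b\oplus g(j)\rangle|w\rangle$, where values are encoded as bit strings. A quantum query algorithm starts in a fixed basis state and applies $U_0,O,U_1,O,U_2,\dots$, where $O$ is the query and the unitaries $U_t$ do not depend on $(f,g)$. If it is stopped after $T$ queries, all registers are measured in the computational basis and an output is read off from the outcome by a fixed function. The query complexity of a problem with error $\varepsilon$ is the least $T$ for which some algorithm, stopped after $T$ queries, outputs on every instance a solution with probability at least $1-\varepsilon$. **Theorem.**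 The problem Find $d$ Smallest Values of Different Type has bounded-error quantum query complexity $O(\sqrt{dN})$. Precisely, for every constant $\varepsilon>0$ there is a constant $C>0$, depending only on $\varepsilon$, such that: 1. for all $N\ge1$, $d'$ and $d$, the query complexity with error $\varepsilon$ of the problem on the instances $(f,g)$ with $\min\{d',e\}=d$ is at most $C\sqrt{dN}$; 2. moreover, for all $N\ge 1$ and $d'$ a single algorithm, depending only on $N$, $d'$ and $\varepsilon$ (so that it does not know $d$), achieves this: for all $f,g$ and every integer $T\ge C\sqrt{dN}$ with $d=\min\{d',e\}$, when stopped after $T$ queries it outputs a solution with probability at least $1-\varepsilon$. The following two problems are special cases. 3. *Find $d$ smallest values of a function*: for $d\le N$, find $I\subseteq[N]$ with $|I|=d$ and $f(i)\le f(j)$ for all $i\in I$, $j\in[N]\setminus I$. If $g$ is injective, its solutions are exactly the solutions of the problem above with $d'=d$. 4. *Find $d$ elements of different type*: find $I\subseteq[N]$ with $|I|=d=\min\{d',e\}$ and $g(i)\neq g(i')$ for all distinct $i,i'\in I$. If $f$ is constant, its solutions are exactly the solutions of the problem above. -/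

import Mathlib

open scoped ENNReal

namespace QuantumMinima

/-! ### The three search problems

`[N]` is `Fin N`.  Values lie in `ℕ ∪ {∞} = ℕ∞`, types in `ℕ`. -/

/-- The number `e = |{g j : j ∈ [N]}|` of different types. -/
def numTypes {N : ℕ} (g : Fin N → ℕ) : ℕ := (Finset.univ.image g).card

/-- Find `d` smallest values of a function: `I` is a set of `d` indices such that
`f i ≤ f j` for all `i ∈ I` and all `j ∉ I`. -/
def IsSmallestValues {N : ℕ} (f : Fin N → ℕ∞) (d : ℕ) (I : Finset (Fin N)) : Prop :=
  I.card = d ∧ ∀ j, j ∉ I → ∀ i ∈ I, f i ≤ f j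

/-- Find `d` elements of different type: `I` is a set of `d = min {d', e}` indices with
pairwise different types. -/
def IsDifferentTypes {N : ℕ} (g : Fin N → ℕ) (d' : ℕ) (I : Finset (Fin N)) : Prop :=
  I.card = min d' (numTypes g) ∧ ∀ i ∈ I, ∀ i' ∈ I, i ≠ i' → g i ≠ g i'

/-- Find `d` smallest values of different type: `I` is a set of `d = min {d', e}` indices with
pairwise different types, such that whenever `j ∉ I`, `i ∈ I` and `f j < f i`, some `i' ∈ I` of
the same type as `j` has `f i' ≤ f j`. -/
def IsSmallestValuesDifferentTypes {N : ℕ} (f : Fin N → ℕ∞) (g : Fin N → ℕ) (d' : ℕ)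
    (I : Finset (Fin N)) : Prop :=
  I.card = min d' (numTypes g) ∧
  (∀ i ∈ I, ∀ i' ∈ I, i ≠ i' → g i ≠ g i') ∧
  (∀ j, j ∉ I → ∀ i ∈ I, f j < f i → ∃ i' ∈ I, g i' = g j ∧ f i' ≤ f j)

/-! ### The quantum query model -/

/-- An input is the black box `j ↦ (f j, g j)`. -/
abbrev Input (N : ℕ) : Type := Fin N → ℕ∞ × ℕ

/-- The Hilbert space `ℓ²(B)` with orthonormal basis indexed by `B`. -/
abbrev L2 (B : Type) : Type := lp (fun _ : B => ℂ) 2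

/-- Permuting coordinates preserves square-summability. -/
theorem memlp_comp_perm {B : Type} (σ : Equiv.Perm B) (ψ : L2 B) :
    Memℓp (fun b => ψ (σ b)) 2 := by
  have h : (0 : ℝ) < (2 : ℝ≥0∞).toReal := by norm_num
  exact memℓp_gen (((lp.memℓp ψ).summable h).comp_injective σ.injective)

/-- The unitary operator `ψ ↦ ψ ∘ σ` for a permutation `σ` of the basis; it maps the basis
vector `|b⟩` to `|σ⁻¹ b⟩`. -/
noncomputable def permuteBasis {B : Type} (σ : Equiv.Perm B) : L2 B ≃ₗᵢ[ℂ] L2 B where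
  toFun ψ := ⟨fun b => ψ (σ b), memlp_comp_perm σ ψ⟩
  invFun ψ := ⟨fun b => ψ (σ.symm b), memlp_comp_perm σ.symm ψ⟩
  map_add' _ _ := rfl
  map_smul' _ _ := rfl
  left_inv ψ := by
    apply lp.ext
    funext b
    change ψ (σ (σ.symm b)) = ψ b
    rw [Equiv.apply_symm_apply]
  right_inv ψ := by
    apply lp.ext
    funext b
    change ψ (σ.symm (σ b)) = ψ b
    rw [Equiv.symm_apply_apply]
  norm_map' ψ := by
    have h : (0 : ℝ) < (2 : ℝ≥0∞).toReal := by norm_num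
    rw [lp.norm_eq_tsum_rpow h, lp.norm_eq_tsum_rpow h]
    congr 1
    exact σ.tsum_eq (fun b => ‖ψ b‖ ^ (2 : ℝ≥0∞).toReal)

/-- Encoding of a value in `ℕ ∪ {∞}` as a bit string (natural number): `∞ ↦ 0`, `n ↦ n + 1`. -/
def encodeValue (v : ℕ∞) : ℕ := if v = ⊤ then 0 else v.toNat + 1

/-- Computational basis: an index register, an answer register consisting of two words of bits
(naturals), and a workspace with basis `W`. -/
abbrev Basis (N : ℕ) (W : Type) : Type := Fin N × (ℕ × ℕ) × W

/-- The map `(j, (a, b), w) ↦ (j, (a ⊕ f j, b ⊕ g j), w)`, with `⊕` bitwise exclusive or. -/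
def queryMap {N : ℕ} {W : Type} (x : Input N) (b : Basis N W) : Basis N W :=
  (b.1, (b.2.1.1 ^^^ encodeValue (x b.1).1, b.2.1.2 ^^^ (x b.1).2), b.2.2)

theorem queryMap_involutive {N : ℕ} {W : Type} (x : Input N) :
    Function.Involutive (queryMap (W := W) x) := by
  rintro ⟨j, ⟨a, b⟩, w⟩
  simp [queryMap]

/-- One query: the unitary `|j⟩|a, b⟩|w⟩ ↦ |j⟩|a ⊕ f j, b ⊕ g j⟩|w⟩`. -/
noncomputable def oracle {N : ℕ} {W : Type} (x : Input N) :
    L2 (Basis N W) ≃ₗᵢ[ℂ] L2 (Basis N W) :=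
  permuteBasis (queryMap_involutive x).toPerm

/-- A quantum query algorithm on inputs of size `N` with outputs in `Out`.  It starts in a basis
state and applies `U 0, O, U 1, O, U 2, …`, where `O` is the oracle and the unitaries `U t` do not
depend on the input.  It can be stopped after any number `T` of queries; then all registers are
measured in the computational basis and the outcome `b` is read as the output `out b`. -/
structure QueryAlgorithm (N : ℕ) (Out : Type) where
  W : Type
  countable_W : Countable W
  init : Basis N W
  U : ℕ → (L2 (Basis N W) ≃ₗᵢ[ℂ] L2 (Basis N W))
  out : Basis N W → Out

namespace QueryAlgorithm

variable {N : ℕ} {Out : Type}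

open Classical in
/-- The state `U_T O U_{T-1} O ⋯ O U_0 |init⟩` after `T` queries to the input `x`. -/
noncomputable def state (A : QueryAlgorithm N Out) (x : Input N) : ℕ → L2 (Basis N A.W)
  | 0 => A.U 0 (lp.single 2 A.init (1 : ℂ))
  | T + 1 => A.U (T + 1) (oracle x (A.state x T))

/-- The probability that the output lies in `S` when `A` is stopped after `T` queries to `x`. -/
noncomputable def outputProb (A : QueryAlgorithm N Out) (x : Input N) (T : ℕ) (S : Set Out) : ℝ :=
  ∑' b, Set.indicator {b | A.out b ∈ S} (fun b => ‖A.state x T b‖ ^ 2) b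

end QueryAlgorithm

/-- The quantum query complexity, with error probability at most `ε`, of the problem with instances
`D` and solution sets `R x`: the least `T` such that some algorithm, stopped after `T` queries,
outputs on every instance `x ∈ D` a solution with probability at least `1 - ε`. -/
noncomputable def queryComplexity {N : ℕ} {Out : Type} (ε : ℝ) (D : Set (Input N))
    (R : Input N → Set Out) : ℕ∞ :=
  ⨅ T ∈ {T : ℕ | ∃ A : QueryAlgorithm N Out, ∀ x ∈ D, 1 - ε ≤ A.outputProb x T (R x)}, (T : ℕ∞)

/-- The solutions of "find `d` smallest values of different type" on the black box `x = (f, g)`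
with parameter `d'`. -/
def solutions {N : ℕ} (d' : ℕ) (x : Input N) : Set (Finset (Fin N)) :=
  {I | IsSmallestValuesDifferentTypes (fun j => (x j).1) (fun j => (x j).2) d' I}

/-- The number `d = min {d', e}` of indices that has to be found on the black box `x = (f, g)`. -/
def targetSize {N : ℕ} (d' : ℕ) (x : Input N) : ℕ := min d' (numTypes (fun j => (x j).2))

end QuantumMinima

namespace QuantumMinima

/-! ### Unitaries on `ℓ²(B)` -/

/-! The algorithm keeps a list of records of known indices, forming a set `S`. Each round is a
Grover search for an index that improves on `S`, and the record of the index it yields joins the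
list. Records are kept in superposition instead of being measured, so the whole procedure is
unitary, while the final measurement sees the list of a classical random process
(`state_searchAlgorithm`, `expect_succ`, `expect_le_outputProb`). Once nothing improves on `S`, a
solution can be read off from the records (`recordSolution_mem_solutions`).

For the running time, let `t` be the number of improving indices. The potential sums `2d - c(y)`
over them, where `c(y)` counts the types with a known element of value at most `f(y)`; it lies
between `dt` and `2dt`. A uniformly random improving index lowers it by at least `max(d, t/4)` on
average (`targetSize_le_potential_sub`, `card_sq_le_sum_potential_sub`), which is a fraction of
order `1 / min(d, t)`. So about `min(d, t)` rounds of cost `√(N/t)` divide `t` by 9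
(`evolve_exceeds_le`). Over the scales `t = 9^j` the cost `min(d, t) √(N/t)` peaks at `t ≈ d`, with
value `√(dN)`, and decays geometrically on both sides.

The iteration counts are fixed in advance. Run `p` guesses `d ≤ 9^p` and at scale `j` makes
`2^|j-p|` times the basic number of rounds: failure probabilities then sum like `2^(-|j-p|)` and
costs like `(2/3)^|j-p|`. The runs `p = 0, 1, 2, …` follow each other, so `d` need not be known;
their costs grow geometrically, and rounds after the first adequate run do no harm
(`expect_exceeds_antitone`). -/

theorem L2.norm_sq_eq {B : Type} (ψ : L2 B) : ‖ψ‖ ^ 2 = ∑' b, ‖ψ b‖ ^ 2 := by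
  have h : (0 : ℝ) < (2 : ℝ≥0∞).toReal := by norm_num
  simpa using lp.norm_rpow_eq_tsum h ψ

theorem L2.summable_sq {B : Type} (ψ : L2 B) : Summable fun b => ‖ψ b‖ ^ 2 := by
  have h : (0 : ℝ) < (2 : ℝ≥0∞).toReal := by norm_num
  simpa using (lp.memℓp ψ).summable h

theorem L2.memℓp_of_summable_sq {B : Type} {φ : B → ℂ} (h : Summable fun b => ‖φ b‖ ^ 2) :
    Memℓp φ 2 :=
  memℓp_gen (by simpa using h)

theorem oracle_apply {N : ℕ} {W : Type} (x : Input N) (ψ : L2 (Basis N W)) (b : Basis N W) :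
    oracle x ψ b = ψ (queryMap x b) := rfl

open Classical in
/-- The sign `-1` on the set `S`, and `1` off it. -/
noncomputable def sign {α : Type} (S : Set α) (a : α) : ℝ := if a ∈ S then -1 else 1

theorem sign_mul_self {α : Type} (S : Set α) (a : α) : sign S a * sign S a = 1 := by
  unfold sign; split_ifs <;> norm_num

theorem abs_sign {α : Type} (S : Set α) (a : α) : |sign S a| = 1 := by
  unfold sign; split_ifs <;> norm_num

theorem norm_sign_mul {α : Type} (S : Set α) (a : α) (z : ℂ) : ‖(sign S a : ℂ) * z‖ = ‖z‖ := by
  rw [norm_mul, Complex.norm_real, Real.norm_eq_abs, abs_sign, one_mul]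

/-- The unitary that changes the sign of the basis vectors in `S`. -/
noncomputable def signFlip {B : Type} (S : Set B) : L2 B ≃ₗᵢ[ℂ] L2 B where
  toFun ψ := ⟨fun b => sign S b * ψ b,
    L2.memℓp_of_summable_sq (by simpa only [norm_sign_mul] using L2.summable_sq ψ)⟩
  invFun ψ := ⟨fun b => sign S b * ψ b,
    L2.memℓp_of_summable_sq (by simpa only [norm_sign_mul] using L2.summable_sq ψ)⟩
  map_add' ψ φ := by
    apply lp.ext; funext b
    exact mul_add _ _ _
  map_smul' c ψ := by
    apply lp.ext; funext b
    exact mul_left_comm _ _ _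
  left_inv ψ := by
    apply lp.ext; funext b
    change (sign S b : ℂ) * (sign S b * ψ b) = ψ b
    rw [← mul_assoc, ← Complex.ofReal_mul, sign_mul_self, Complex.ofReal_one, one_mul]
  right_inv ψ := by
    apply lp.ext; funext b
    change (sign S b : ℂ) * (sign S b * ψ b) = ψ b
    rw [← mul_assoc, ← Complex.ofReal_mul, sign_mul_self, Complex.ofReal_one, one_mul]
  norm_map' ψ := by
    rw [← sq_eq_sq₀ (norm_nonneg _) (norm_nonneg _), L2.norm_sq_eq, L2.norm_sq_eq]
    exact tsum_congr fun b => by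
      change ‖(sign S b : ℂ) * ψ b‖ ^ 2 = _
      rw [norm_sign_mul]

@[simp]
theorem signFlip_apply {B : Type} (S : Set B) (ψ : L2 B) (b : B) :
    signFlip S ψ b = sign S b * ψ b := rfl

section Fiberwise

variable {N : ℕ} {C : Type}

/-- The component of `ψ` in the copy of `ℂ^N` over `c`. -/
noncomputable def fiber (ψ : Fin N × C → ℂ) (c : C) : EuclideanSpace ℂ (Fin N) :=
  WithLp.toLp 2 fun j => ψ (j, c)

theorem summable_norm_fiber_sq {ψ : Fin N × C → ℂ} :
    (Summable fun c => ‖fiber ψ c‖ ^ 2) ↔ Summable fun b => ‖ψ b‖ ^ 2 := by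
  have hE : ∀ c, ‖fiber ψ c‖ ^ 2 = ∑ j, ‖ψ (j, c)‖ ^ 2 := fun c => EuclideanSpace.norm_sq_eq _
  rw [summable_prod_of_nonneg (fun _ => sq_nonneg _)]
  refine ⟨fun h => ⟨fun j => ?_, Summable.of_finite⟩, fun h => ?_⟩
  · refine Summable.of_nonneg_of_le (fun _ => sq_nonneg _) (fun c => ?_) h
    rw [hE]
    exact Finset.single_le_sum (f := fun j => ‖ψ (j, c)‖ ^ 2) (fun _ _ => sq_nonneg _)
      (Finset.mem_univ j)
  · simp_rw [hE]
    exact summable_sum fun j _ => h.1 j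

theorem tsum_norm_fiber_sq {ψ : Fin N × C → ℂ} (h : Summable fun b => ‖ψ b‖ ^ 2) :
    ∑' c, ‖fiber ψ c‖ ^ 2 = ∑' b, ‖ψ b‖ ^ 2 := by
  have hE : ∀ c, ‖fiber ψ c‖ ^ 2 = ∑ j, ‖ψ (j, c)‖ ^ 2 := fun c => EuclideanSpace.norm_sq_eq _
  have h1 := ((summable_prod_of_nonneg (fun _ => sq_nonneg _)).1 h).1
  simp_rw [hE]
  rw [h.tsum_prod' h1, Summable.tsum_finsetSum fun j _ => h1 j]
  exact (tsum_fintype _).symm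

theorem fiberwise_summable (V : EuclideanSpace ℂ (Fin N) ≃ₗᵢ[ℂ] EuclideanSpace ℂ (Fin N))
    (ψ : L2 (Fin N × C)) :
    Summable fun b : Fin N × C => ‖V (fiber ψ b.2) b.1‖ ^ 2 := by
  rw [← summable_norm_fiber_sq]
  have : Summable fun c => ‖V (fiber ψ c)‖ ^ 2 := by
    simpa only [LinearIsometryEquiv.norm_map] using summable_norm_fiber_sq.2 (L2.summable_sq ψ)
  exact this

/-- The unitary that applies `V` to the first register. -/
noncomputable def fiberwise (V : EuclideanSpace ℂ (Fin N) ≃ₗᵢ[ℂ] EuclideanSpace ℂ (Fin N)) :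
    L2 (Fin N × C) ≃ₗᵢ[ℂ] L2 (Fin N × C) where
  toFun ψ := ⟨fun b => V (fiber ψ b.2) b.1, L2.memℓp_of_summable_sq (fiberwise_summable V ψ)⟩
  invFun ψ := ⟨fun b => V.symm (fiber ψ b.2) b.1,
    L2.memℓp_of_summable_sq (fiberwise_summable V.symm ψ)⟩
  map_add' ψ φ := by
    apply lp.ext; funext b
    change V (fiber ψ b.2 + fiber φ b.2) b.1 = _
    rw [map_add]; rfl
  map_smul' a ψ := by
    apply lp.ext; funext b
    change V (a • fiber ψ b.2) b.1 = _
    rw [map_smul]; rfl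
  left_inv ψ := by
    apply lp.ext; funext b
    change V.symm (V (fiber ψ b.2)) b.1 = _
    rw [LinearIsometryEquiv.symm_apply_apply]; rfl
  right_inv ψ := by
    apply lp.ext; funext b
    change V (V.symm (fiber ψ b.2)) b.1 = _
    rw [LinearIsometryEquiv.apply_symm_apply]; rfl
  norm_map' ψ := by
    rw [← sq_eq_sq₀ (norm_nonneg _) (norm_nonneg _), L2.norm_sq_eq, L2.norm_sq_eq,
      ← tsum_norm_fiber_sq (L2.summable_sq ψ)]
    refine (tsum_norm_fiber_sq (fiberwise_summable V ψ)).symm.trans (tsum_congr fun c => ?_)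
    rw [← V.norm_map (fiber ψ c)]; rfl

end Fiberwise

/-! ### Reflections of the index register -/

section Reflections

variable {N : ℕ} {C : Type}

/-- The uniform superposition of all indices. -/
noncomputable def uniformVector (N : ℕ) : EuclideanSpace ℂ (Fin N) :=
  WithLp.toLp 2 fun _ => (((√N)⁻¹ : ℝ) : ℂ)

/-- Grover's diffusion operator: the reflection about the uniform superposition. -/
noncomputable def diffusion : L2 (Fin N × C) ≃ₗᵢ[ℂ] L2 (Fin N × C) :=
  fiberwise (ℂ ∙ uniformVector N).reflection

/-- A reflection that exchanges `|j₀⟩` and the uniform superposition. -/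
noncomputable def prepare (j₀ : Fin N) : L2 (Fin N × C) ≃ₗᵢ[ℂ] L2 (Fin N × C) :=
  fiberwise (ℂ ∙ (EuclideanSpace.single j₀ (1 : ℂ) + uniformVector N)).reflection

theorem norm_uniformVector_sq (hN : 0 < N) : ‖uniformVector N‖ ^ 2 = 1 := by
  have : (N : ℝ) ≠ 0 := by positivity
  rw [EuclideanSpace.norm_sq_eq]
  simp [uniformVector, this]

theorem ofReal_norm_uniformVector_sq (hN : 0 < N) :
    (RCLike.ofReal ‖uniformVector N‖ : ℂ) ^ 2 = 1 := by
  rw [← RCLike.ofReal_pow, norm_uniformVector_sq hN, RCLike.ofReal_one]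

theorem reflection_uniformVector_apply (hN : 0 < N) (v : EuclideanSpace ℂ (Fin N)) (j : Fin N) :
    (ℂ ∙ uniformVector N).reflection v j = 2 / N * ∑ k, v k - v j := by
  have h2 : (((√N : ℝ) : ℂ)⁻¹ * ((√N : ℝ) : ℂ)⁻¹) = (N : ℂ)⁻¹ := by
    rw [← mul_inv, ← Complex.ofReal_mul, Real.mul_self_sqrt (Nat.cast_nonneg _)]
    simp
  have h3 : inner ℂ (uniformVector N) v = ((√N : ℝ) : ℂ)⁻¹ * ∑ k, v k := by
    rw [PiLp.inner_apply, Finset.mul_sum]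
    refine Finset.sum_congr rfl fun k _ => ?_
    simp [uniformVector, mul_comm]
  rw [Submodule.reflection_singleton_apply, ofReal_norm_uniformVector_sq hN, h3]
  simp only [uniformVector, PiLp.sub_apply, PiLp.smul_apply, smul_eq_mul, nsmul_eq_mul,
    div_one, Complex.ofReal_inv]
  push_cast
  rw [div_eq_mul_inv, ← h2]
  ring

theorem diffusion_apply (hN : 0 < N) (ψ : L2 (Fin N × C)) (j : Fin N) (c : C) :
    diffusion ψ (j, c) = 2 / N * ∑ k, ψ (k, c) - ψ (j, c) :=
  reflection_uniformVector_apply hN (fiber ψ c) j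

/-- Two unit vectors with real inner product are exchanged by the reflection about the line through
their sum. The sum is nonzero since the inner product is `1/√N > -1`. -/
theorem reflection_single_add_uniformVector (hN : 0 < N) (j₀ : Fin N) :
    (ℂ ∙ (EuclideanSpace.single j₀ (1 : ℂ) + uniformVector N)).reflection
      (EuclideanSpace.single j₀ (1 : ℂ)) = uniformVector N := by
  set e : EuclideanSpace ℂ (Fin N) := EuclideanSpace.single j₀ (1 : ℂ) with he
  set u := uniformVector N with hu
  have hue : inner ℂ u e = (((√N)⁻¹ : ℝ) : ℂ) := by
    rw [he, EuclideanSpace.inner_single_right]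
    simp [hu, uniformVector]
  have heu : inner ℂ e u = (((√N)⁻¹ : ℝ) : ℂ) := by
    rw [he, EuclideanSpace.inner_single_left]
    simp [hu, uniformVector]
  have hee : inner ℂ e e = 1 := by rw [he, EuclideanSpace.inner_single_right]; simp
  have huu : inner ℂ u u = 1 := by
    rw [inner_self_eq_norm_sq_to_K, hu, ofReal_norm_uniformVector_sq hN]
  have hn : (RCLike.ofReal ‖e + u‖ : ℂ) ^ 2 = 2 * (1 + (((√N)⁻¹ : ℝ) : ℂ)) := by
    rw [← inner_self_eq_norm_sq_to_K (𝕜 := ℂ) (e + u), inner_add_left, inner_add_right,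
      inner_add_right, hee, huu, hue, heu]
    ring
  have hpos : (1 + (((√N)⁻¹ : ℝ) : ℂ)) ≠ 0 := by
    rw [← Complex.ofReal_one, ← Complex.ofReal_add, Complex.ofReal_ne_zero]
    positivity
  have hc : (1 + (((√N)⁻¹ : ℝ) : ℂ)) / (2 * (1 + (((√N)⁻¹ : ℝ) : ℂ))) = 1 / 2 := by
    generalize (1 + (((√N)⁻¹ : ℝ) : ℂ)) = z at hpos
    field_simp
  rw [Submodule.reflection_singleton_apply, inner_add_left, hee, hue, hn, hc,
    ← Nat.cast_smul_eq_nsmul ℂ, smul_smul]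
  norm_num

theorem prepare_apply (hN : 0 < N) (j₀ : Fin N) (ψ : L2 (Fin N × C)) (c : C)
    (h0 : ∀ k, k ≠ j₀ → ψ (k, c) = 0) (j : Fin N) :
    prepare j₀ ψ (j, c) = ψ (j₀, c) * (((√N)⁻¹ : ℝ) : ℂ) := by
  have hf : fiber ψ c = ψ (j₀, c) • EuclideanSpace.single j₀ (1 : ℂ) := by
    ext k
    by_cases hk : k = j₀
    · subst hk; simp [fiber]
    · simp [fiber, hk, h0 k hk]
  have h : prepare j₀ ψ (j, c) = (ℂ ∙ (EuclideanSpace.single j₀ (1 : ℂ) +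
    uniformVector N)).reflection (fiber ψ c) j := rfl
  rw [h, hf, map_smul, reflection_single_add_uniformVector hN]
  rfl

end Reflections

/-! ### Amplitudes in Grover's search -/

section Grover

variable {N : ℕ}

/-- The amplitudes after `m` iterations of Grover's search for an element of `M`. -/
noncomputable def groverAmp (M : Set (Fin N)) : ℕ → Fin N → ℝ
  | 0, _ => (√N)⁻¹
  | m + 1, j => 2 / N * ∑ k, sign M k * groverAmp M m k - sign M j * groverAmp M m j

open Classical in
theorem sum_mul_ite_mem (M : Set (Fin N)) (u v : ℝ) :
    ∑ k, (if k ∈ M then u else v) = M.ncard * u + (N - M.ncard) * v := by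
  rw [Finset.sum_ite, Finset.sum_const, Finset.sum_const, nsmul_eq_mul, nsmul_eq_mul]
  have h1 : (Finset.univ.filter fun k => k ∈ M).card = M.ncard := by
    rw [← Set.ncard_coe_finset]; simp
  have h2 := Finset.card_filter_add_card_filter_not (s := (Finset.univ : Finset (Fin N)))
    (fun k => k ∈ M)
  rw [Finset.card_univ, Fintype.card_fin, h1] at h2
  have h3 : (M.ncard : ℝ) + (Finset.univ.filter fun k => k ∉ M).card = N := by exact_mod_cast h2
  rw [h1, ← h3]
  ring

theorem ncard_le (M : Set (Fin N)) : (M.ncard : ℝ) ≤ N := by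
  exact_mod_cast (Set.ncard_le_card M).trans (Nat.card_fin N).le

-- The two reflections of an iteration compose to a rotation by `2θ` in the plane spanned by the
-- uniform superpositions of marked and of unmarked indices. The factors `√|M|` and `√(N - |M|)`
-- stay on the left so that `M` may be empty or everything.
open Classical in
theorem groverAmp_eq (hN : 0 < N) (M : Set (Fin N)) {θ : ℝ}
    (hs : Real.sin θ = √(M.ncard / N)) (hc : Real.cos θ = √((N - M.ncard) / N)) (m : ℕ) :
    ∃ u v : ℝ, (∀ j, groverAmp M m j = if j ∈ M then u else v) ∧
      √M.ncard * u = Real.sin ((2 * m + 1) * θ) ∧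
      √(N - M.ncard) * v = Real.cos ((2 * m + 1) * θ) := by
  have hN' : (0 : ℝ) < N := by exact_mod_cast hN
  have hNs : √(N : ℝ) ≠ 0 := (Real.sqrt_pos.2 hN').ne'
  have ht := ncard_le M
  set t : ℝ := (M.ncard : ℝ) with ht'
  have ht0 : 0 ≤ t := by positivity
  rw [Real.sqrt_div ht0] at hs
  rw [Real.sqrt_div (by linarith)] at hc
  induction m with
  | zero =>
    refine ⟨(√N)⁻¹, (√N)⁻¹, fun j => by simp [groverAmp], ?_, ?_⟩
    · simp [hs, div_eq_mul_inv]
    · simp [hc, div_eq_mul_inv]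
  | succ m ih =>
    obtain ⟨u, v, huv, hu, hv⟩ := ih
    have hsum : ∑ k, sign M k * groverAmp M m k = t * (-u) + (N - t) * v := by
      rw [← sum_mul_ite_mem]
      refine Finset.sum_congr rfl fun k _ => ?_
      rw [huv, sign]; split_ifs <;> ring
    have e : √t = √N * Real.sin θ := by rw [hs]; field_simp
    have e' : √(N - t) = √N * Real.cos θ := by rw [hc]; field_simp
    have e1 : t = N * Real.sin θ ^ 2 := by
      rw [← Real.sq_sqrt ht0, e, mul_pow, Real.sq_sqrt hN'.le]
    have e2 : N - t = N * Real.cos θ ^ 2 := by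
      rw [← Real.sq_sqrt (show (0 : ℝ) ≤ N - t by linarith), e', mul_pow, Real.sq_sqrt hN'.le]
    have hsc := Real.sin_sq_add_cos_sq θ
    refine ⟨2 / N * (t * (-u) + (N - t) * v) + u, 2 / N * (t * (-u) + (N - t) * v) - v,
      fun j => ?_, ?_, ?_⟩
    · rw [groverAmp, hsum, huv, sign]; split_ifs <;> ring
    · rw [show (2 * ((m + 1 : ℕ) : ℝ) + 1) * θ = (2 * m + 1) * θ + 2 * θ by push_cast; ring,
        Real.sin_add, ← hu, ← hv, e, e', e1, show N - N * Real.sin θ ^ 2 = N * Real.cos θ ^ 2 by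
          rw [← e1, e2], Real.sin_two_mul, Real.cos_two_mul']
      field_simp
      linear_combination (-(Real.sin θ * u)) * hsc
    · rw [show (2 * ((m + 1 : ℕ) : ℝ) + 1) * θ = (2 * m + 1) * θ + 2 * θ by push_cast; ring,
        Real.cos_add, ← hu, ← hv, e, e', e1, show N - N * Real.sin θ ^ 2 = N * Real.cos θ ^ 2 by
          rw [← e1, e2], Real.sin_two_mul, Real.cos_two_mul']
      field_simp
      linear_combination ((Real.cos θ * v)) * hsc

theorem exists_grover_angle (hN : 0 < N) (M : Set (Fin N)) :
    ∃ θ : ℝ, 0 ≤ θ ∧ θ ≤ Real.pi / 2 ∧ Real.sin θ = √(M.ncard / N) ∧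
      Real.cos θ = √((N - M.ncard) / N) := by
  have hN' : (0 : ℝ) < N := by exact_mod_cast hN
  have ht := ncard_le M
  have h1 : √((M.ncard : ℝ) / N) ≤ 1 := Real.sqrt_le_one.2 ((div_le_one hN').2 ht)
  refine ⟨Real.arcsin √(M.ncard / N), Real.arcsin_nonneg.2 (Real.sqrt_nonneg _),
    Real.arcsin_le_pi_div_two _,
    Real.sin_arcsin (by linarith [Real.sqrt_nonneg ((M.ncard : ℝ) / N)]) h1, ?_⟩
  rw [Real.cos_arcsin, Real.sq_sqrt (by positivity), sub_div, div_self hN'.ne']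

open Classical in
theorem sum_groverAmp_sq (hN : 0 < N) (M : Set (Fin N)) (m : ℕ) :
    ∑ j, groverAmp M m j ^ 2 = 1 := by
  obtain ⟨θ, -, -, hs, hc⟩ := exists_grover_angle hN M
  obtain ⟨u, v, huv, hu, hv⟩ := groverAmp_eq hN M hs hc m
  have : ∑ j, groverAmp M m j ^ 2 = ∑ j, if j ∈ M then u ^ 2 else v ^ 2 :=
    Finset.sum_congr rfl fun j _ => by rw [huv]; split_ifs <;> rfl
  rw [this, sum_mul_ite_mem, ← Real.sin_sq_add_cos_sq ((2 * m + 1) * θ), ← hu, ← hv, mul_pow,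
    mul_pow, Real.sq_sqrt (Nat.cast_nonneg _), Real.sq_sqrt (by linarith [ncard_le M])]

/-- If `(2m+1)² |M|` is of the order of `N`, then after `m` Grover iterations each element of `M`
is found with the same probability, which is at least a constant over `|M|`. -/
theorem exists_groverAmp_sq_eq (hN : 0 < N) (M : Set (Fin N)) (m : ℕ)
    (h1 : (2 * m + 1) ^ 2 * M.ncard ≤ N) (h2 : N ≤ 81 * ((2 * m + 1) ^ 2 * M.ncard)) :
    ∃ p : ℝ, (∀ j ∈ M, groverAmp M m j ^ 2 = p) ∧ 1 / 243 ≤ M.ncard * p := by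
  obtain ⟨θ, hθ0, hθ1, hs, hc⟩ := exists_grover_angle hN M
  obtain ⟨u, v, huv, hu, hv⟩ := groverAmp_eq hN M hs hc m
  refine ⟨u ^ 2, fun j hj => by rw [huv, if_pos hj], ?_⟩
  have hN' : (0 : ℝ) < N := by exact_mod_cast hN
  set L : ℝ := 2 * m + 1 with hL
  have hL0 : 0 < L := by positivity
  set t : ℝ := (M.ncard : ℝ) with ht
  have ht0 : 0 ≤ t := by positivity
  have h1' : L ^ 2 * t ≤ N := by rw [hL, ht]; exact_mod_cast h1
  have h2' : N ≤ 81 * (L ^ 2 * t) := by rw [hL, ht]; exact_mod_cast h2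
  have hpi := Real.pi_pos
  have hmul : L * √(t / N) = √(L ^ 2 * t / N) := by
    rw [mul_div_assoc, Real.sqrt_mul (sq_nonneg L), Real.sqrt_sq hL0.le]
  -- Jordan's inequality `sin θ ≥ 2θ/π`: the rotation does not overshoot the marked direction.
  have hup : L * θ ≤ Real.pi / 2 := by
    have hb := Real.mul_le_sin hθ0 hθ1
    rw [hs] at hb
    have : √(L ^ 2 * t / N) ≤ 1 := Real.sqrt_le_one.2 ((div_le_one hN').2 h1')
    rw [← hmul] at this
    have h3 : L * (2 / Real.pi * θ) ≤ 1 := (mul_le_mul_of_nonneg_left hb hL0.le).trans this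
    have h4 : L * θ * 2 ≤ Real.pi := by
      rw [show L * (2 / Real.pi * θ) = (L * θ * 2) / Real.pi by ring, div_le_one hpi] at h3
      exact h3
    linarith
  have hlow : 1 / 9 ≤ L * θ := by
    have hb := Real.sin_le hθ0
    rw [hs] at hb
    refine le_trans ?_ (mul_le_mul_of_nonneg_left hb hL0.le)
    rw [hmul]
    apply Real.le_sqrt_of_sq_le
    rw [le_div_iff₀ hN']
    linarith
  have hsin := Real.mul_le_sin (by positivity) hup
  have h3 : t * u ^ 2 = Real.sin (L * θ) ^ 2 := by
    rw [← hu, mul_pow, Real.sq_sqrt ht0]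
  rw [h3]
  have h4 : 2 / (9 * Real.pi) ≤ Real.sin (L * θ) := by
    refine le_trans ?_ hsin
    rw [show 2 / (9 * Real.pi) = 2 / Real.pi * (1 / 9) by field_simp]
    exact mul_le_mul_of_nonneg_left hlow (by positivity)
  -- The success probability is then at least `1/15² = 1/225`, which exceeds `1/243`.
  have h5 : (1 : ℝ) / 15 ≤ 2 / (9 * Real.pi) := by
    rw [div_le_div_iff₀ (by norm_num) (by positivity)]
    linarith [Real.pi_lt_d2]
  nlinarith [h4, h5]

end Grover

/-! ### Iterated Grover search with a record of the results -/

section Search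

variable {N : ℕ}

/-- An index together with an encoded pair (value, type). -/
abbrev Record (N : ℕ) : Type := Fin N × (ℕ × ℕ)

/-- The encoded answer of the black box to the query `j`. -/
def answer (x : Input N) (j : Fin N) : ℕ × ℕ := (encodeValue (x j).1, (x j).2)

/-- The record of the query `j`. -/
def record (x : Input N) (j : Fin N) : Record N := (j, answer x j)

/-- On lists of length `r` as workspace: move the contents of the first two registers to the
list, leaving `|j₀⟩|0, 0⟩`; extended to an involution of the basis. -/
def store (j₀ : Fin N) (r : ℕ) : Basis N (List (Record N)) → Basis N (List (Record N))
  | (j, ab, w) =>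
    if w.length = r then (j₀, (0, 0), (j, ab) :: w)
    else if j = j₀ ∧ ab = (0, 0) ∧ w.length = r + 1 then
      match w with
      | [] => (j, ab, [])
      | ρ :: h => (ρ.1, ρ.2, h)
    else (j, ab, w)

theorem store_involutive (j₀ : Fin N) (r : ℕ) : Function.Involutive (store j₀ r) := by
  rintro ⟨j, ab, w⟩
  by_cases h1 : w.length = r
  · simp [store, h1]
  · by_cases h2 : j = j₀ ∧ ab = (0, 0) ∧ w.length = r + 1
    · obtain ⟨rfl, rfl, h3⟩ := h2
      cases w with
      | nil => simp at h3
      | cons ρ h =>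
        have h4 : h.length = r := by simpa using h3
        simp [store, h4]
    · simp [store, h1, h2]

/-- The position of the algorithm after `T` queries: the number of completed rounds, and the number
of queries made in the current round. Round `r` consists of `2 * m r + 1` queries. -/
def clock (m : ℕ → ℕ) : ℕ → ℕ × ℕ
  | 0 => (0, 0)
  | T + 1 => if (clock m T).2 < 2 * m (clock m T).1 then ((clock m T).1, (clock m T).2 + 1)
      else ((clock m T).1 + 1, 0)

/-- The unitary that is applied at a given position. -/
noncomputable def searchUnitary (j₀ : Fin N) (mark : List (Record N) → Set (Record N)) :
    ℕ × ℕ → (L2 (Basis N (List (Record N))) ≃ₗᵢ[ℂ] L2 (Basis N (List (Record N))))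
  | (0, 0) => prepare j₀
  | (r + 1, 0) => (permuteBasis (store_involutive j₀ r).toPerm).trans (prepare j₀)
  | (_, i + 1) =>
    if Even i then signFlip {b | ((b.1, b.2.1) : Record N) ∈ mark b.2.2} else diffusion

/-- The algorithm that in round `r` applies `m r` iterations of Grover's search for an index whose
record is marked with respect to the list of previous records, and then adds the record of the
index that it finds to the list. -/
noncomputable def searchAlgorithm {Out : Type} (j₀ : Fin N) (m : ℕ → ℕ)
    (mark : List (Record N) → Set (Record N)) (out : List (Record N) → Out) :
    QueryAlgorithm N Out where
  W := List (Record N)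
  countable_W := inferInstance
  init := (j₀, (0, 0), [])
  U T := searchUnitary j₀ mark (clock m T)
  out b := out b.2.2

/-- The set of indices whose records are marked. -/
def markedIndices (x : Input N) (mark : List (Record N) → Set (Record N)) (w : List (Record N)) :
    Set (Fin N) := {j | record x j ∈ mark w}

/-- The amplitude of a list of records. -/
noncomputable def recordAmp (x : Input N) (m : ℕ → ℕ) (mark : List (Record N) → Set (Record N)) :
    List (Record N) → ℝ
  | [] => 1
  | ρ :: w => if ρ.2 = answer x ρ.1 then
      recordAmp x m mark w * groverAmp (markedIndices x mark w) (m w.length) ρ.1 else 0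

open Classical in
/-- The state in round `r`, after `k` Grover iterations. -/
noncomputable def roundState (x : Input N) (m : ℕ → ℕ) (mark : List (Record N) → Set (Record N))
    (r k : ℕ) (b : Basis N (List (Record N))) : ℂ :=
  if b.2.2.length = r ∧ b.2.1 = (0, 0) then
    ((recordAmp x m mark b.2.2 * groverAmp (markedIndices x mark b.2.2) k b.1 : ℝ) : ℂ) else 0

open Classical in
/-- The state in round `r`, after `k` Grover iterations and the first half of the next one. -/
noncomputable def roundState' (x : Input N) (m : ℕ → ℕ) (mark : List (Record N) → Set (Record N))
    (r k : ℕ) (b : Basis N (List (Record N))) : ℂ :=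
  if b.2.2.length = r ∧ b.2.1 = answer x b.1 then
    ((recordAmp x m mark b.2.2 * (sign (markedIndices x mark b.2.2) b.1 *
      groverAmp (markedIndices x mark b.2.2) k b.1) : ℝ) : ℂ) else 0

theorem xor_answer_eq_zero_iff (x : Input N) (j : Fin N) (ab : ℕ × ℕ) :
    (ab.1 ^^^ encodeValue (x j).1, ab.2 ^^^ (x j).2) = (0, 0) ↔ ab = answer x j := by
  rw [Prod.ext_iff, Prod.ext_iff]
  simp [answer]

theorem xor_answer_eq_answer_iff (x : Input N) (j : Fin N) (ab : ℕ × ℕ) :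
    (ab.1 ^^^ encodeValue (x j).1, ab.2 ^^^ (x j).2) = answer x j ↔ ab = (0, 0) := by
  rw [Prod.ext_iff, Prod.ext_iff]
  simp [answer]

variable (x : Input N) (m : ℕ → ℕ) (mark : List (Record N) → Set (Record N))

theorem oracle_roundState (r k : ℕ) (ψ : L2 (Basis N (List (Record N))))
    (h : ∀ b, ψ b = roundState x m mark r k b) (j : Fin N) (ab : ℕ × ℕ) (w : List (Record N))
    [Decidable (w.length = r ∧ ab = answer x j)] :
    oracle x ψ (j, ab, w) = if w.length = r ∧ ab = answer x j then
      ((recordAmp x m mark w * groverAmp (markedIndices x mark w) k j : ℝ) : ℂ) else 0 := by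
  rw [oracle_apply, h, queryMap, roundState]
  simp only [xor_answer_eq_zero_iff]

/-- The first query of an iteration puts the answer next to the index, so the mark can be read off
from the registers and the sign is applied without knowledge of the input. -/
theorem signFlip_oracle_roundState (r k : ℕ) (ψ : L2 (Basis N (List (Record N))))
    (h : ∀ b, ψ b = roundState x m mark r k b) (b : Basis N (List (Record N))) :
    signFlip {b | ((b.1, b.2.1) : Record N) ∈ mark b.2.2} (oracle x ψ) b =
      roundState' x m mark r k b := by
  classical
  obtain ⟨j, ab, w⟩ := b
  rw [signFlip_apply, oracle_roundState x m mark r k ψ h, roundState']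
  by_cases hc : w.length = r ∧ ab = answer x j
  · rw [if_pos hc, if_pos hc]
    obtain ⟨-, rfl⟩ := hc
    have : sign {b : Basis N (List (Record N)) | ((b.1, b.2.1) : Record N) ∈ mark b.2.2}
        (j, answer x j, w) = sign (markedIndices x mark w) j := rfl
    rw [this]
    push_cast
    ring
  · rw [if_neg hc, if_neg hc, mul_zero]

/-- The second query erases the answer. This uncomputation is needed because the diffusion mixes
only amplitudes with equal answer registers and equal lists. -/
theorem diffusion_oracle_roundState' (hN : 0 < N) (r k : ℕ)
    (ψ : L2 (Basis N (List (Record N)))) (h : ∀ b, ψ b = roundState' x m mark r k b)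
    (b : Basis N (List (Record N))) :
    (diffusion : L2 (Basis N (List (Record N))) ≃ₗᵢ[ℂ] _) (oracle x ψ) b =
      roundState x m mark r (k + 1) b := by
  classical
  obtain ⟨j, ab, w⟩ := b
  have ho : ∀ i, oracle x ψ (i, ab, w) = if w.length = r ∧ ab = (0, 0) then
      ((recordAmp x m mark w * (sign (markedIndices x mark w) i *
        groverAmp (markedIndices x mark w) k i) : ℝ) : ℂ) else 0 := by
    intro i
    rw [oracle_apply, h, queryMap, roundState']
    simp only [xor_answer_eq_answer_iff]
  rw [diffusion_apply hN, ho]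
  simp only [ho]
  rw [roundState]
  by_cases hc : w.length = r ∧ ab = (0, 0)
  · simp only [if_pos hc]
    rw [groverAmp]
    push_cast
    rw [← Finset.mul_sum]
    ring
  · simp [if_neg hc]

/-- The last query of a round turns the index into a true record. Moving it to the list returns the
first two registers to a fixed basis state, from which the next round can start. -/
theorem store_oracle_roundState (j₀ : Fin N) (r : ℕ) (ψ : L2 (Basis N (List (Record N))))
    (h : ∀ b, ψ b = roundState x m mark r (m r) b) (j : Fin N) (ab : ℕ × ℕ)
    (w : List (Record N)) [Decidable (w.length = r + 1 ∧ ab = (0, 0) ∧ j = j₀)] :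
    oracle x ψ (store j₀ r (j, ab, w)) = if w.length = r + 1 ∧ ab = (0, 0) ∧ j = j₀ then
      (recordAmp x m mark w : ℂ) else 0 := by
  classical
  by_cases h1 : w.length = r
  · have : store j₀ r (j, ab, w) = (j₀, (0, 0), (j, ab) :: w) := by simp [store, h1]
    rw [this, oracle_roundState x m mark r (m r) ψ h, if_neg (by simp [h1]), if_neg (by omega)]
  · by_cases h2 : j = j₀ ∧ ab = (0, 0) ∧ w.length = r + 1
    · rw [if_pos ⟨h2.2.2, h2.2.1, h2.1⟩]
      obtain ⟨rfl, rfl, h3⟩ := h2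
      cases w with
      | nil => simp at h3
      | cons ρ v =>
        have h4 : v.length = r := by simpa using h3
        have : store j r (j, (0, 0), ρ :: v) = (ρ.1, ρ.2, v) := by simp [store, h4]
        rw [this, oracle_roundState x m mark r (m r) ψ h, recordAmp, h4]
        simp only [true_and]
        split_ifs <;> simp
    · have : store j₀ r (j, ab, w) = (j, ab, w) := by simp [store, h1, h2]
      rw [this, oracle_roundState x m mark r (m r) ψ h, if_neg (fun hc => h1 hc.1),
        if_neg (fun hc => h2 ⟨hc.2.2, hc.2.1, hc.1⟩)]

theorem prepare_roundState (hN : 0 < N) (j₀ : Fin N) (r : ℕ) (ψ : L2 (Basis N (List (Record N))))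
    (h : ∀ j ab w, ψ (j, ab, w) = open Classical in
      if w.length = r ∧ ab = (0, 0) ∧ j = j₀ then (recordAmp x m mark w : ℂ) else 0)
    (b : Basis N (List (Record N))) :
    (prepare j₀ : L2 (Basis N (List (Record N))) ≃ₗᵢ[ℂ] _) ψ b =
      roundState x m mark r 0 b := by
  classical
  obtain ⟨j, ab, w⟩ := b
  rw [prepare_apply hN, h, roundState]
  · by_cases hc : w.length = r ∧ ab = (0, 0)
    · rw [if_pos ⟨hc.1, hc.2, rfl⟩, if_pos hc, groverAmp]
      push_cast; rfl
    · rw [if_neg (fun hh => hc ⟨hh.1, hh.2.1⟩), if_neg hc, zero_mul]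
  · intro k hk
    rw [h, if_neg (fun hh => hk hh.2.2)]

open Classical in
theorem lp_single_one_apply {B : Type} {_ : DecidableEq B} (i b : B) :
    (lp.single 2 i (1 : ℂ) : L2 B) b = if b = i then 1 else 0 := by
  rw [lp.single_apply, Pi.single_apply]

variable {Out : Type} (out : List (Record N) → Out)

/-- The answer register is clear after an even number of queries of a round and filled after an odd
number. Induction on `T` passes between these two forms, or into a new round. -/
theorem state_searchAlgorithm (hN : 0 < N) (j₀ : Fin N) (T : ℕ) :
    (∃ k ≤ m (clock m T).1, (clock m T).2 = 2 * k ∧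
      ∀ b, (searchAlgorithm j₀ m mark out).state x T b =
        roundState x m mark (clock m T).1 k b) ∨
    (∃ k < m (clock m T).1, (clock m T).2 = 2 * k + 1 ∧
      ∀ b, (searchAlgorithm j₀ m mark out).state x T b =
        roundState' x m mark (clock m T).1 k b) := by
  classical
  induction T with
  | zero =>
    refine Or.inl ⟨0, Nat.zero_le _, rfl, prepare_roundState x m mark hN j₀ 0 _ fun j ab w => ?_⟩
    refine (lp_single_one_apply (B := Basis N (List (Record N))) (j₀, (0, 0), [])
      (j, ab, w)).trans ?_
    by_cases hc : w.length = 0 ∧ ab = (0, 0) ∧ j = j₀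
    · obtain ⟨h1, rfl, rfl⟩ := hc
      obtain rfl := List.length_eq_zero_iff.1 h1
      simp [recordAmp]
    · rw [if_neg hc]
      refine if_neg fun hh => ?_
      simp only [Prod.mk.injEq] at hh
      obtain ⟨rfl, rfl, rfl⟩ := hh
      exact hc ⟨rfl, rfl, rfl⟩
  | succ T ih =>
    have hstate : (searchAlgorithm j₀ m mark out).state x (T + 1) =
      searchUnitary j₀ mark (clock m (T + 1))
        (oracle x ((searchAlgorithm j₀ m mark out).state x T)) := rfl
    rw [hstate]
    generalize (searchAlgorithm j₀ m mark out).state x T = ψ at ih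
    rcases hcl : clock m T with ⟨r, i⟩
    rw [hcl] at ih
    simp only at ih
    rcases ih with ⟨k, hk, rfl, hψ⟩ | ⟨k, hk, rfl, hψ⟩
    · rcases hk.lt_or_eq with hk | rfl
      · have h1 : clock m (T + 1) = (r, 2 * k + 1) := by
          rw [clock, hcl, if_pos (by simpa using hk)]
        right
        rw [h1]
        refine ⟨k, hk, rfl, fun b => ?_⟩
        rw [searchUnitary, if_pos (even_two_mul k)]
        exact signFlip_oracle_roundState x m mark r k ψ hψ b
      · have h1 : clock m (T + 1) = (r + 1, 0) := by
          rw [clock, hcl, if_neg (by simp)]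
        left
        rw [h1]
        refine ⟨0, Nat.zero_le _, rfl, fun b => ?_⟩
        rw [searchUnitary]
        refine prepare_roundState x m mark hN j₀ (r + 1) _ (fun j ab w => ?_) b
        exact store_oracle_roundState x m mark j₀ r ψ hψ j ab w
    · have h1 : clock m (T + 1) = (r, 2 * k + 1 + 1) := by
        rw [clock, hcl, if_pos (by simp; omega)]
      left
      rw [h1]
      refine ⟨k + 1, hk, by simp; ring, fun b => ?_⟩
      rw [searchUnitary, if_neg (by simp)]
      exact diffusion_oracle_roundState' x m mark hN r k ψ hψ b

end Search

/-! ### The distribution of the measured indices -/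

section Paths

variable {N : ℕ}

/-- `(j, l) ↦ j :: l` as an embedding. -/
def consEmbedding (α : Type) : α × List α ↪ List α where
  toFun q := q.1 :: q.2
  inj' _ _ h := Prod.ext (List.cons.inj h).1 (List.cons.inj h).2

/-- The lists of indices of length `r`. -/
def paths (N : ℕ) : ℕ → Finset (List (Fin N))
  | 0 => {[]}
  | r + 1 => (Finset.univ ×ˢ paths N r).map (consEmbedding (Fin N))

theorem length_of_mem_paths {r : ℕ} {l : List (Fin N)} (h : l ∈ paths N r) : l.length = r := by
  induction r generalizing l with
  | zero => simp_all [paths]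
  | succ r ih =>
    obtain ⟨q, hq, rfl⟩ := Finset.mem_map.1 h
    exact congrArg (· + 1) (ih (Finset.mem_product.1 hq).2)

/-- The probability amplitude of finding the list `l` of indices (the last one first), if the
indices in `P l` are the marked ones after `l` has been found. -/
noncomputable def pathAmp (P : List (Fin N) → Set (Fin N)) (m : ℕ → ℕ) : List (Fin N) → ℝ
  | [] => 1
  | j :: l => pathAmp P m l * groverAmp (P l) (m l.length) j

/-- The expectation of `F l` for the list `l` of indices found in `r` rounds. -/
noncomputable def expect (P : List (Fin N) → Set (Fin N)) (m : ℕ → ℕ) (r : ℕ)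
    (F : List (Fin N) → ℝ) : ℝ := ∑ l ∈ paths N r, pathAmp P m l ^ 2 * F l

/-- The expectation of `F` after one more round with `k` Grover iterations. -/
noncomputable def roundExpect (P : List (Fin N) → Set (Fin N)) (k : ℕ) (F : List (Fin N) → ℝ)
    (l : List (Fin N)) : ℝ := ∑ j, groverAmp (P l) k j ^ 2 * F (j :: l)

variable (P : List (Fin N) → Set (Fin N)) (m : ℕ → ℕ)

theorem expect_zero (F : List (Fin N) → ℝ) : expect P m 0 F = F [] := by
  simp [expect, paths, pathAmp]

/-- Different lists are orthogonal, so there is no interference between them: squared amplitudes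
multiply along a list like the transition probabilities of a classical process. -/
theorem expect_succ (r : ℕ) (F : List (Fin N) → ℝ) :
    expect P m (r + 1) F = expect P m r (roundExpect P (m r) F) := by
  rw [expect, expect, paths, Finset.sum_map, Finset.sum_product, Finset.sum_comm]
  refine Finset.sum_congr rfl fun l hl => ?_
  rw [roundExpect, Finset.mul_sum]
  refine Finset.sum_congr rfl fun j _ => ?_
  rw [← length_of_mem_paths hl, show consEmbedding (Fin N) (j, l) = j :: l from rfl, pathAmp,
    mul_pow, mul_assoc]

theorem expect_mono {r : ℕ} {F G : List (Fin N) → ℝ} (h : ∀ l, F l ≤ G l) :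
    expect P m r F ≤ expect P m r G :=
  Finset.sum_le_sum fun l _ => mul_le_mul_of_nonneg_left (h l) (sq_nonneg _)

theorem roundExpect_mono {k : ℕ} {F G : List (Fin N) → ℝ} {l : List (Fin N)}
    (h : ∀ j, F (j :: l) ≤ G (j :: l)) : roundExpect P k F l ≤ roundExpect P k G l :=
  Finset.sum_le_sum fun j _ => mul_le_mul_of_nonneg_left (h j) (sq_nonneg _)

theorem roundExpect_const (hN : 0 < N) (k : ℕ) (c : ℝ) (l : List (Fin N)) :
    roundExpect P k (fun _ => c) l = c := by
  rw [roundExpect, ← Finset.sum_mul, sum_groverAmp_sq hN, one_mul]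

theorem expect_const (hN : 0 < N) (r : ℕ) (c : ℝ) : expect P m r (fun _ => c) = c := by
  induction r with
  | zero => exact expect_zero P m _
  | succ r ih =>
    rw [expect_succ]
    refine Eq.trans ?_ ih
    congr 1
    funext l
    exact roundExpect_const P hN _ c l

theorem recordAmp_map (x : Input N) (mark : List (Record N) → Set (Record N))
    (l : List (Fin N)) :
    recordAmp x m mark (l.map (record x)) =
      pathAmp (fun l => markedIndices x mark (l.map (record x))) m l := by
  induction l with
  | nil => rfl
  | cons j l ih => simp [recordAmp, pathAmp, record, ← ih]

theorem record_injective (x : Input N) : Function.Injective (record x) :=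
  fun _ _ h => congrArg Prod.fst h

/-- The round in progress does not affect the distribution of the list, as its Grover amplitudes
have total square 1. The function `a` is the content of the answer register. Keeping only the
finitely many basis states that carry true records gives the inequality. -/
theorem expect_le_sum_norm_sq (hN : 0 < N) (x : Input N)
    (mark : List (Record N) → Set (Record N)) (r k : ℕ) (S : Set (List (Record N)))
    (ψ : Basis N (List (Record N)) → ℂ) (hψ : Summable fun b => ‖ψ b‖ ^ 2) (a : Fin N → ℕ × ℕ)
    (h : ∀ j w, w.length = r → ‖ψ (j, a j, w)‖ ^ 2 =
      recordAmp x m mark w ^ 2 * groverAmp (markedIndices x mark w) k j ^ 2) :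
    expect (fun l => markedIndices x mark (l.map (record x))) m r
        (Set.indicator {l | l.map (record x) ∈ S} 1) ≤
      ∑' b, Set.indicator {b | b.2.2 ∈ S} (fun b => ‖ψ b‖ ^ 2) b := by
  classical
  let g : Fin N × List (Fin N) ↪ Basis N (List (Record N)) :=
    ⟨fun q => (q.1, a q.1, q.2.map (record x)), fun q q' h => by
      simp only [Prod.mk.injEq] at h
      exact Prod.ext h.1 ((record_injective x).list_map h.2.2)⟩
  refine le_trans (le_of_eq ?_) ((hψ.indicator _).sum_le_tsum
    ((Finset.univ ×ˢ paths N r).map g) fun b _ => Set.indicator_nonneg (fun _ _ => sq_nonneg _) b)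
  rw [Finset.sum_map, Finset.sum_product, Finset.sum_comm, expect]
  refine Finset.sum_congr rfl fun l hl => ?_
  by_cases hS : l.map (record x) ∈ S
  · rw [Set.indicator_of_mem (by exact hS), Pi.one_apply, mul_one]
    have : ∀ j, Set.indicator {b : Basis N (List (Record N)) | b.2.2 ∈ S}
        (fun b => ‖ψ b‖ ^ 2) (g (j, l)) = pathAmp (fun l => markedIndices x mark
          (l.map (record x))) m l ^ 2 *
            groverAmp (markedIndices x mark (l.map (record x))) k j ^ 2 := by
      intro j
      rw [Set.indicator_of_mem (by exact hS), ← recordAmp_map]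
      exact h j _ (by rw [List.length_map, length_of_mem_paths hl])
    simp only [this]
    rw [← Finset.mul_sum, sum_groverAmp_sq hN, mul_one]
  · rw [Set.indicator_of_notMem (by exact hS), mul_zero]
    exact (Finset.sum_eq_zero fun j _ => Set.indicator_of_notMem (by exact hS) _).symm

theorem expect_le_outputProb {Out : Type} (hN : 0 < N) (j₀ : Fin N) (x : Input N)
    (mark : List (Record N) → Set (Record N)) (out : List (Record N) → Out) (T : ℕ)
    (S : Set Out) :
    expect (fun l => markedIndices x mark (l.map (record x))) m (clock m T).1
        (Set.indicator {l | out (l.map (record x)) ∈ S} 1) ≤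
      (searchAlgorithm j₀ m mark out).outputProb x T S := by
  have hs := L2.summable_sq ((searchAlgorithm j₀ m mark out).state x T)
  rcases state_searchAlgorithm x m mark out hN j₀ T with ⟨k, -, -, h⟩ | ⟨k, -, -, h⟩
  · refine expect_le_sum_norm_sq m hN x mark _ k (out ⁻¹' S) _ hs (fun _ => (0, 0))
      fun j w hw => ?_
    refine (congrArg (fun z : ℂ => ‖z‖ ^ 2) (h _)).trans ?_
    rw [roundState, if_pos ⟨hw, rfl⟩, Complex.norm_real, Real.norm_eq_abs, sq_abs, mul_pow]
  · refine expect_le_sum_norm_sq m hN x mark _ k (out ⁻¹' S) _ hs (answer x)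
      fun j w hw => ?_
    refine (congrArg (fun z : ℂ => ‖z‖ ^ 2) (h _)).trans ?_
    rw [roundState', if_pos ⟨hw, rfl⟩, Complex.norm_real, Real.norm_eq_abs, sq_abs, mul_pow,
      mul_pow, pow_two (sign _ _), sign_mul_self, one_mul]

/-- The number of queries in the first `r` rounds. -/
def roundStart (r : ℕ) : ℕ := ∑ s ∈ Finset.range r, (2 * m s + 1)

theorem roundStart_clock (T : ℕ) :
    roundStart m (clock m T).1 + (clock m T).2 = T ∧ (clock m T).2 ≤ 2 * m (clock m T).1 := by
  induction T with
  | zero => simp [clock, roundStart]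
  | succ T ih =>
    rw [clock]
    split_ifs with h
    · exact ⟨by simp only; omega, h⟩
    · refine ⟨?_, Nat.zero_le _⟩
      simp only [roundStart, Finset.sum_range_succ] at ih ⊢
      omega

theorem le_clock {r T : ℕ} (h : roundStart m r ≤ T) : r ≤ (clock m T).1 := by
  by_contra! hlt
  have h1 := roundStart_clock m T
  have h2 : roundStart m ((clock m T).1 + 1) ≤ roundStart m r :=
    Finset.sum_le_sum_of_subset (Finset.range_mono hlt)
  rw [roundStart, Finset.sum_range_succ] at h2
  rw [← roundStart] at h2
  omega

end Paths

/-! ### Indices that improve on a set of known indices -/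

section Improving

/-- The types of the elements of `S` with value at most `v`. -/
def seenTypes {α : Type} (F : α → ℕ∞ × ℕ) (S : Finset α) (v : ℕ∞) : Finset ℕ :=
  (S.filter fun i => (F i).1 ≤ v).image fun i => (F i).2

/-- The index `i` improves on `S` if `S` has no element of the type of `i` which is at most as
large, and fewer than `d'` types have elements in `S` that are at most as large. -/
def Improves {α : Type} (F : α → ℕ∞ × ℕ) (d' : ℕ) (S : Finset α) (i : α) : Prop :=
  (F i).2 ∉ seenTypes F S (F i).1 ∧ (seenTypes F S (F i).1).card < d'

theorem mem_seenTypes {α : Type} {F : α → ℕ∞ × ℕ} {S : Finset α} {v : ℕ∞} {τ : ℕ} :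
    τ ∈ seenTypes F S v ↔ ∃ i ∈ S, (F i).1 ≤ v ∧ (F i).2 = τ := by
  simp [seenTypes, and_assoc]

theorem seenTypes_mono {α : Type} {F : α → ℕ∞ × ℕ} {S S' : Finset α} {v v' : ℕ∞}
    (hS : S ⊆ S') (hv : v ≤ v') : seenTypes F S v ⊆ seenTypes F S' v' := by
  intro τ h
  obtain ⟨i, hi, h1, h2⟩ := mem_seenTypes.1 h
  exact mem_seenTypes.2 ⟨i, hS hi, h1.trans hv, h2⟩

variable {N : ℕ} (x : Input N) (d' : ℕ)

open Classical in
/-- The indices that improve on `S`. -/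
noncomputable def improving (S : Finset (Fin N)) : Finset (Fin N) :=
  Finset.univ.filter (Improves x d' S)

variable {x d'}

theorem mem_improving {S : Finset (Fin N)} {j : Fin N} :
    j ∈ improving x d' S ↔ Improves x d' S j := by
  simp [improving]

theorem improving_antitone {S S' : Finset (Fin N)} (h : S ⊆ S') :
    improving x d' S' ⊆ improving x d' S := by
  intro j hj
  rw [mem_improving] at hj ⊢
  have hs := seenTypes_mono (F := x) h (le_refl (x j).1)
  exact ⟨fun h1 => hj.1 (hs h1), (Finset.card_le_card hs).trans_lt hj.2⟩

/-- The type of `j` is itself not among the counted ones, so the count is also below `e`. This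
bounds every summand of the potential between `d` and `2d`. -/
theorem card_seenTypes_lt {S : Finset (Fin N)} {j : Fin N} (hj : j ∈ improving x d' S) :
    (seenTypes x S (x j).1).card < targetSize d' x := by
  rw [mem_improving] at hj
  refine lt_min hj.2 ?_
  rw [numTypes]
  apply Finset.card_lt_card
  rw [Finset.ssubset_iff_of_subset]
  · exact ⟨(x j).2, Finset.mem_image_of_mem _ (Finset.mem_univ _), hj.1⟩
  · intro τ h
    obtain ⟨i, -, -, rfl⟩ := mem_seenTypes.1 h
    exact Finset.mem_image_of_mem _ (Finset.mem_univ _)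

variable (x d')

/-- The potential of `S`; it vanishes if and only if no index improves on `S`. -/
noncomputable def potential (S : Finset (Fin N)) : ℝ :=
  ∑ y ∈ improving x d' S, (2 * (targetSize d' x : ℝ) - (seenTypes x S (x y).1).card)

variable {x d'}

theorem targetSize_mul_card_le_potential (S : Finset (Fin N)) :
    (targetSize d' x : ℝ) * (improving x d' S).card ≤ potential x d' S := by
  rw [mul_comm, ← nsmul_eq_mul, potential]
  refine Finset.card_nsmul_le_sum _ _ _ fun y hy => ?_
  have : ((seenTypes x S (x y).1).card : ℝ) ≤ targetSize d' x := by
    exact_mod_cast (card_seenTypes_lt hy).le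
  linarith

theorem potential_le (S : Finset (Fin N)) :
    potential x d' S ≤ 2 * targetSize d' x * (improving x d' S).card := by
  rw [mul_comm, ← nsmul_eq_mul, potential]
  refine Finset.sum_le_card_nsmul _ _ _ fun y hy => ?_
  have : (0 : ℝ) ≤ ((seenTypes x S (x y).1).card : ℝ) := Nat.cast_nonneg _
  linarith

theorem potential_nonneg (S : Finset (Fin N)) : 0 ≤ potential x d' S :=
  (by positivity : (0 : ℝ) ≤ _).trans (targetSize_mul_card_le_potential S)

-- An index that stops improving releases its whole weight, which is at least `d` because weights
-- start at `2d`; one that remains loses the number of newly seen types.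
open Classical in
theorem sum_le_potential_sub {S S' : Finset (Fin N)} (h : S ⊆ S') (c : Fin N → ℝ)
    (h1 : ∀ z ∈ improving x d' S, z ∉ improving x d' S' → c z ≤ targetSize d' x)
    (h2 : ∀ z ∈ improving x d' S', c z ≤
      ((seenTypes x S' (x z).1).card : ℝ) - (seenTypes x S (x z).1).card) :
    ∑ z ∈ improving x d' S, c z ≤ potential x d' S - potential x d' S' := by
  have h3 : potential x d' S' = ∑ z ∈ improving x d' S, if z ∈ improving x d' S' then
      (2 * (targetSize d' x : ℝ) - (seenTypes x S' (x z).1).card) else 0 := by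
    rw [← Finset.sum_filter, potential, Finset.filter_mem_eq_inter,
      Finset.inter_eq_right.2 (improving_antitone h)]
  rw [h3, potential, ← Finset.sum_sub_distrib]
  refine Finset.sum_le_sum fun z hz => ?_
  split_ifs with hz'
  · have := h2 z hz'
    linarith
  · have := h1 z hz hz'
    have h4 : ((seenTypes x S (x z).1).card : ℝ) ≤ targetSize d' x := by
      exact_mod_cast (card_seenTypes_lt hz).le
    linarith

theorem card_seenTypes_mono {S S' : Finset (Fin N)} (h : S ⊆ S') (v : ℕ∞) :
    ((seenTypes x S v).card : ℝ) ≤ (seenTypes x S' v).card := by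
  exact_mod_cast Finset.card_le_card (seenTypes_mono h le_rfl)

theorem potential_antitone {S S' : Finset (Fin N)} (h : S ⊆ S') :
    potential x d' S' ≤ potential x d' S := by
  have := sum_le_potential_sub (x := x) (d' := d') h (fun _ => 0)
    (fun _ _ _ => Nat.cast_nonneg _)
    (fun z _ => sub_nonneg.2 (card_seenTypes_mono h _))
  simp only [Finset.sum_const_zero] at this
  linarith

open Classical in
/-- The decrease of the potential when `y` becomes known. -/
theorem potential_insert (S : Finset (Fin N)) (y : Fin N) :
    ∑ z ∈ improving x d' S, (if (x y).1 ≤ (x z).1 then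
        (if (x z).2 = (x y).2 then (targetSize d' x : ℝ)
          else if (x y).2 ∉ seenTypes x S (x z).1 then 1 else 0) else 0) ≤
      potential x d' S - potential x d' (insert y S) := by
  have hsub : S ⊆ insert y S := Finset.subset_insert _ _
  refine sum_le_potential_sub hsub _ (fun z hz _ => ?_) fun z hz => ?_
  · have : (1 : ℝ) ≤ targetSize d' x := by
      exact_mod_cast (Nat.zero_le _).trans_lt (card_seenTypes_lt hz)
    split_ifs <;> linarith
  · have h0 := card_seenTypes_mono (x := x) hsub (x z).1
    split_ifs with h1 h2 h3
    -- An index of the type of `y` that is not smaller than `y` no longer improves.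
    · exact absurd (mem_seenTypes.2 ⟨y, Finset.mem_insert_self _ _, h1, h2.symm⟩)
        (mem_improving.1 hz).1
    · linarith
    · have h4 : insert (x y).2 (seenTypes x S (x z).1) ⊆ seenTypes x (insert y S) (x z).1 :=
        Finset.insert_subset (mem_seenTypes.2 ⟨y, Finset.mem_insert_self _ _, h1, rfl⟩)
          (seenTypes_mono hsub le_rfl)
      have h5 := Finset.card_le_card h4
      rw [Finset.card_insert_of_notMem h3] at h5
      have h6 : ((seenTypes x S (x z).1).card : ℝ) + 1 ≤
        (seenTypes x (insert y S) (x z).1).card := by exact_mod_cast h5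
      linarith
    · linarith

-- Only the term of `y` itself is used: a known index does not improve.
open Classical in
theorem targetSize_le_potential_sub {S : Finset (Fin N)} {y : Fin N}
    (hy : y ∈ improving x d' S) :
    (targetSize d' x : ℝ) ≤ potential x d' S - potential x d' (insert y S) := by
  refine le_trans ?_ (potential_insert S y)
  refine le_trans ?_ (Finset.single_le_sum (fun z _ => ?_) hy)
  · simp
  · split_ifs <;> positivity

/-- Of the pairs `(y, z)` and `(z, y)` at least one is in increasing order. -/
theorem sum_sum_le_two_mul_of_symm {α β : Type} [LinearOrder β] (A : Finset α) (f : α → β)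
    (s : α → α → ℝ) (hs : ∀ y z, s y z = s z y) (h0 : ∀ y z, 0 ≤ s y z) :
    ∑ y ∈ A, ∑ z ∈ A, s y z ≤ 2 * ∑ y ∈ A, ∑ z ∈ A, if f y ≤ f z then s y z else 0 := by
  have h1 : ∑ y ∈ A, ∑ z ∈ A, s y z ≤ ∑ y ∈ A, ∑ z ∈ A,
      ((if f y ≤ f z then s y z else 0) + if f z ≤ f y then s z y else 0) := by
    refine Finset.sum_le_sum fun y _ => Finset.sum_le_sum fun z _ => ?_
    have := h0 y z
    rw [hs z y]
    rcases le_total (f y) (f z) with h | h <;> rw [if_pos h] <;> split_ifs <;> linarith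
  refine h1.trans (le_of_eq ?_)
  simp only [Finset.sum_add_distrib]
  rw [two_mul]
  congr 1
  exact Finset.sum_comm

/-- Cauchy–Schwarz for the sizes of the fibres of `g`. -/
theorem card_sq_le_card_mul_sum {α : Type} (A : Finset α) (g : α → ℕ) (T : Finset ℕ)
    (h : ∀ y ∈ A, g y ∈ T) :
    (A.card : ℝ) ^ 2 ≤ T.card * ∑ y ∈ A, ∑ z ∈ A, if g z = g y then 1 else 0 := by
  have h1 : (A.card : ℝ) = ∑ τ ∈ T, ((A.filter fun z => g z = τ).card : ℝ) := by
    exact_mod_cast Finset.card_eq_sum_card_fiberwise h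
  have h2 : (∑ y ∈ A, ∑ z ∈ A, if g z = g y then 1 else 0 : ℝ) =
      ∑ τ ∈ T, ((A.filter fun z => g z = τ).card : ℝ) ^ 2 := by
    rw [← Finset.sum_fiberwise_of_maps_to h]
    refine Finset.sum_congr rfl fun τ _ => ?_
    rw [Finset.sum_congr rfl (g := fun _ => ((A.filter fun z => g z = τ).card : ℝ))]
    · rw [Finset.sum_const, nsmul_eq_mul, sq]
    · intro y hy
      rw [(Finset.mem_filter.1 hy).2, Finset.sum_boole]
  rw [h1, h2]
  exact sq_sum_le_card_mul_sum_sq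

open Classical in
/-- On average over the improving indices, the potential decreases by at least a quarter of their
number. -/
theorem card_sq_le_sum_potential_sub (S : Finset (Fin N)) :
    ((improving x d' S).card : ℝ) ^ 2 / 4 ≤
      ∑ y ∈ improving x d' S, (potential x d' S - potential x d' (insert y S)) := by
  set G := improving x d' S with hG
  rcases G.eq_empty_or_nonempty with h | h
  · simp [h]
  -- With `z₀` of largest value, `T` contains the types seen below any improving index, yet has at
  -- most `d` elements.
  obtain ⟨z₀, hz₀, hmax⟩ := G.exists_max_image (fun z => (x z).1) h
  set T := seenTypes x S (x z₀).1 with hT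
  set d : ℝ := (targetSize d' x : ℝ) with hd
  have hTd : (T.card : ℝ) ≤ d := by
    rw [hd]; exact_mod_cast (card_seenTypes_lt hz₀).le
  have hd1 : 1 ≤ d := by
    rw [hd]; exact_mod_cast (Nat.zero_le _).trans_lt (card_seenTypes_lt hz₀)
  set A := G.filter fun y => (x y).2 ∈ T with hA
  set B := G.filter fun y => (x y).2 ∉ T with hB
  have hcard : (A.card : ℝ) + B.card = G.card := by
    exact_mod_cast Finset.card_filter_add_card_filter_not (s := G) fun y => (x y).2 ∈ T
  set c : Fin N → Fin N → ℝ := fun y z => if (x y).1 ≤ (x z).1 then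
        (if (x z).2 = (x y).2 then d
          else if (x y).2 ∉ seenTypes x S (x z).1 then 1 else 0) else 0 with hc
  have hc0 : ∀ y z, 0 ≤ c y z := by
    intro y z
    simp only [hc]
    split_ifs <;> positivity
  -- Indices of types in `T`: at least `|A|²/d` ordered pairs share a type, and each one in
  -- increasing order counts `d`.
  have hold : (A.card : ℝ) ^ 2 ≤ 2 * ∑ y ∈ A, ∑ z ∈ G, c y z := by
    have h1 := card_sq_le_card_mul_sum A (fun y => (x y).2) T
      fun y hy => (Finset.mem_filter.1 hy).2
    have h2 := sum_sum_le_two_mul_of_symm A (fun y => (x y).1)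
      (fun y z => if (x z).2 = (x y).2 then d else 0)
      (fun y z => by simp only [eq_comm]) (fun y z => by split_ifs <;> positivity)
    have h3 : ∑ y ∈ A, ∑ z ∈ A, (if (x y).1 ≤ (x z).1 then
        (if (x z).2 = (x y).2 then d else 0) else 0) ≤ ∑ y ∈ A, ∑ z ∈ G, c y z := by
      refine Finset.sum_le_sum fun y _ => le_trans (Finset.sum_le_sum fun z _ => ?_)
        (Finset.sum_le_sum_of_subset_of_nonneg (Finset.filter_subset _ G) fun z _ _ => hc0 y z)
      simp only [hc]
      split_ifs <;> norm_num
    have h4 : (∑ y ∈ A, ∑ z ∈ A, if (x z).2 = (x y).2 then d else 0) =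
        d * ∑ y ∈ A, ∑ z ∈ A, if (x z).2 = (x y).2 then 1 else 0 := by
      simp only [Finset.mul_sum, mul_ite, mul_one, mul_zero]
    have h5 : (0 : ℝ) ≤ ∑ y ∈ A, ∑ z ∈ A, if (x z).2 = (x y).2 then 1 else 0 :=
      Finset.sum_nonneg fun y _ => Finset.sum_nonneg fun z _ => by split_ifs <;> norm_num
    have h6 := mul_le_mul_of_nonneg_right hTd h5
    linarith
  -- Indices of types outside `T`: every pair in increasing order counts at least 1.
  have hnew : (B.card : ℝ) ^ 2 ≤ 2 * ∑ y ∈ B, ∑ z ∈ G, c y z := by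
    have h2 := sum_sum_le_two_mul_of_symm B (fun y => (x y).1) (fun _ _ => 1)
      (fun _ _ => rfl) (fun _ _ => zero_le_one)
    have h3 : ∑ y ∈ B, ∑ z ∈ B, (if (x y).1 ≤ (x z).1 then 1 else 0) ≤
        ∑ y ∈ B, ∑ z ∈ G, c y z := by
      refine Finset.sum_le_sum fun y hy => le_trans (Finset.sum_le_sum fun z hz => ?_)
        (Finset.sum_le_sum_of_subset_of_nonneg (Finset.filter_subset _ G) fun z _ _ => hc0 y z)
      have h4 : (x y).2 ∉ seenTypes x S (x z).1 := fun h =>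
        (Finset.mem_filter.1 hy).2
          (seenTypes_mono subset_rfl (hmax z (Finset.mem_filter.1 hz).1) h)
      simp only [hc]
      split_ifs <;> linarith
    simp only [Finset.sum_const, nsmul_eq_mul, mul_one] at h2
    rw [sq]
    linarith
  have hsum : ∑ y ∈ G, ∑ z ∈ G, c y z =
      ∑ y ∈ A, ∑ z ∈ G, c y z + ∑ y ∈ B, ∑ z ∈ G, c y z :=
    (Finset.sum_filter_add_sum_filter_not G _ _).symm
  have hle : ∑ y ∈ G, ∑ z ∈ G, c y z ≤
      ∑ y ∈ G, (potential x d' S - potential x d' (insert y S)) :=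
    Finset.sum_le_sum fun y _ => potential_insert S y
  rw [← hcard]
  nlinarith [sq_nonneg ((A.card : ℝ) - B.card)]

end Improving

/-! ### Solutions among the known indices -/

section PartialSolutions

variable {N : ℕ}

/-- `I` solves the problem "find `d` smallest values of different type" restricted to `S`. -/
def IsPartialSolution (x : Input N) (d' : ℕ) (S I : Finset (Fin N)) : Prop :=
  I ⊆ S ∧ I.card = min d' (S.image fun i => (x i).2).card ∧
  (∀ i ∈ I, ∀ i' ∈ I, i ≠ i' → (x i).2 ≠ (x i').2) ∧
  (∀ j ∈ S, ∀ i ∈ I, (x j).1 < (x i).1 → ∃ i' ∈ I, (x i').2 = (x j).2 ∧ (x i').1 ≤ (x j).1)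

/-- Greedy choice: keep adding an element of least value among those whose type is not yet
represented. -/
theorem exists_isPartialSolution (x : Input N) (d' : ℕ) (S : Finset (Fin N)) :
    ∃ I, IsPartialSolution x d' S I := by
  classical
  induction d' with
  | zero => exact ⟨∅, by simp [IsPartialSolution]⟩
  | succ d' ih =>
    obtain ⟨I, h1, h2, h3, h4⟩ := ih
    rcases le_or_gt (S.image fun i => (x i).2).card d' with hle | hlt
    · refine ⟨I, h1, ?_, h3, h4⟩
      rw [h2, min_eq_right hle, min_eq_right (by omega)]
    · rw [min_eq_left hlt.le] at h2
      set R := S.filter fun z => (x z).2 ∉ I.image fun i => (x i).2 with hR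
      have hne : R.Nonempty := by
        by_contra hemp
        rw [Finset.not_nonempty_iff_eq_empty, hR, Finset.filter_eq_empty_iff] at hemp
        have hsub : (S.image fun i => (x i).2) ⊆ I.image fun i => (x i).2 := by
          intro τ hτ
          obtain ⟨z, hz, rfl⟩ := Finset.mem_image.1 hτ
          exact not_not.1 (hemp hz)
        have := (Finset.card_le_card hsub).trans Finset.card_image_le
        omega
      obtain ⟨z, hz, hmin⟩ := R.exists_min_image (fun z => (x z).1) hne
      obtain ⟨hzS, hzI⟩ := Finset.mem_filter.1 hz
      have hzI' : ∀ i ∈ I, (x i).2 ≠ (x z).2 := fun i hi h =>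
        hzI (Finset.mem_image.2 ⟨i, hi, h⟩)
      have hz0 : z ∉ I := fun h => hzI' z h rfl
      refine ⟨insert z I, Finset.insert_subset hzS h1, ?_, ?_, ?_⟩
      · rw [Finset.card_insert_of_notMem hz0, h2, min_eq_left hlt]
      · intro i hi i' hi' hii
        rcases Finset.mem_insert.1 hi with rfl | hm <;>
          rcases Finset.mem_insert.1 hi' with rfl | hm'
        · exact absurd rfl hii
        · exact (hzI' i' hm').symm
        · exact hzI' i hm
        · exact h3 i hm i' hm' hii
      · intro j hj i hi hji
        rcases Finset.mem_insert.1 hi with rfl | hi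
        · have hjR : j ∉ R := fun h => (hmin j h).not_gt hji
          have : (x j).2 ∈ I.image fun i => (x i).2 := by
            by_contra hcon
            exact hjR (Finset.mem_filter.2 ⟨hj, hcon⟩)
          obtain ⟨i', hi', hij⟩ := Finset.mem_image.1 this
          refine ⟨i', Finset.mem_insert_of_mem hi', hij, ?_⟩
          -- Otherwise the old property, applied to `j` and `i'`, gives an element of the same type
          -- that is smaller than `i'`, although types in `I` are distinct.
          by_contra! hcon
          obtain ⟨k, hk, hkj, hkf⟩ := h4 j hj i' hi' hcon
          have : k = i' := by
            by_contra hne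
            exact h3 k hk i' hi' hne (hkj.trans hij.symm)
          subst this
          exact hkf.not_gt hcon
        · obtain ⟨i', hi', h⟩ := h4 j hj i hi hji
          exact ⟨i', Finset.mem_insert_of_mem hi', h⟩

theorem IsPartialSolution.congr {x y : Input N} {d' : ℕ} {S I : Finset (Fin N)}
    (h : IsPartialSolution x d' S I) (hxy : ∀ j ∈ S, x j = y j) : IsPartialSolution y d' S I := by
  obtain ⟨h1, h2, h3, h4⟩ := h
  refine ⟨h1, ?_, fun i hi i' hi' => ?_, fun j hj i hi => ?_⟩
  · rw [h2]
    congr 2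
    exact Finset.image_congr fun i hi => by rw [hxy i hi]
  · rw [← hxy i (h1 hi), ← hxy i' (h1 hi')]
    exact h3 i hi i' hi'
  · rw [← hxy j hj, ← hxy i (h1 hi)]
    intro hji
    obtain ⟨i', hi', h⟩ := h4 j hj i hi hji
    exact ⟨i', hi', by rwa [← hxy i' (h1 hi')]⟩

/-- If no index improves on `S`, then the problem restricted to `S` is the whole problem. -/
theorem IsPartialSolution.mem_solutions {x : Input N} {d' : ℕ} {S I : Finset (Fin N)}
    (h : IsPartialSolution x d' S I) (hS : improving x d' S = ∅) : I ∈ solutions d' x := by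
  classical
  obtain ⟨h1, h2, h3, h4⟩ := h
  have hS' : ∀ j, (x j).2 ∉ seenTypes x S (x j).1 → d' ≤ (seenTypes x S (x j).1).card := by
    intro j hj
    by_contra! hlt
    have : j ∈ improving x d' S := mem_improving.2 ⟨hj, hlt⟩
    simp [hS] at this
  have hsub : ∀ v, seenTypes x S v ⊆ S.image fun i => (x i).2 := fun v =>
    Finset.image_subset_image (Finset.filter_subset _ _)
  refine ⟨?_, h3, ?_⟩
  · rw [h2]
    have hle : (S.image fun i => (x i).2).card ≤ numTypes fun j => (x j).2 :=
      Finset.card_le_card (Finset.image_subset_image (Finset.subset_univ _))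
    rcases le_or_gt d' (S.image fun i => (x i).2).card with h | h
    · rw [min_eq_left h, min_eq_left (h.trans hle)]
    -- If `S` has fewer than `d'` types, any index of a missing type would improve.
    · have : (Finset.univ.image fun i => (x i).2) ⊆ S.image fun i => (x i).2 := by
        intro τ hτ
        obtain ⟨j, -, rfl⟩ := Finset.mem_image.1 hτ
        by_contra hj
        have := hS' j fun h => hj (hsub _ h)
        have := this.trans (Finset.card_le_card (hsub _))
        omega
      have hge := Finset.card_le_card this
      congr 1
      exact le_antisymm hle hge
  · intro j _ i hi hji
    change (x j).1 < (x i).1 at hji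
    change ∃ i' ∈ I, (x i').2 = (x j).2 ∧ (x i').1 ≤ (x j).1
    have hin : ∀ τ ∈ seenTypes x S (x j).1, ∃ i' ∈ I, (x i').2 = τ ∧ (x i').1 ≤ (x j).1 := by
      intro τ hτ
      obtain ⟨z, hz, hzj, rfl⟩ := mem_seenTypes.1 hτ
      obtain ⟨i', hi', h6, h7⟩ := h4 z hz i hi (hzj.trans_lt hji)
      exact ⟨i', hi', h6, h7.trans hzj⟩
    by_cases hj : (x j).2 ∈ seenTypes x S (x j).1
    · exact hin _ hj
    · exfalso
      -- The types seen up to `f j` are represented in `I` by elements smaller than `i`, so there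
      -- are fewer than `|I| ≤ d'` of them and `j` would improve.
      have h6 : seenTypes x S (x j).1 ⊆ (I.erase i).image fun i => (x i).2 := by
        intro τ hτ
        obtain ⟨i', hi', rfl, h8⟩ := hin τ hτ
        refine Finset.mem_image.2 ⟨i', Finset.mem_erase.2 ⟨?_, hi'⟩, rfl⟩
        rintro rfl
        exact h8.not_gt hji
      have h7 := (hS' j hj).trans ((Finset.card_le_card h6).trans Finset.card_image_le)
      rw [Finset.card_erase_of_mem hi, h2] at h7
      have h8 : 0 < I.card := Finset.card_pos.2 ⟨i, hi⟩
      rw [h2] at h8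
      omega

/-! ### Reading the records -/

/-- The value encoded by a bit string. -/
def decodeValue : ℕ → ℕ∞
  | 0 => ⊤
  | n + 1 => n

theorem decodeValue_encodeValue (v : ℕ∞) : decodeValue (encodeValue v) = v := by
  unfold encodeValue
  split_ifs with h
  · rw [h]; rfl
  · exact ENat.natCast_toNat h

/-- The value and the type in a record. -/
def recordData (ρ : Record N) : ℕ∞ × ℕ := (decodeValue ρ.2.1, ρ.2.2)

theorem recordData_record (x : Input N) (j : Fin N) : recordData (record x j) = x j :=
  Prod.ext (decodeValue_encodeValue _) rfl

/-- The records that improve on a list of records. -/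
def improvingRecords (d' : ℕ) (w : List (Record N)) : Set (Record N) :=
  {ρ | Improves recordData d' w.toFinset ρ}

theorem seenTypes_records (x : Input N) (l : List (Fin N)) (v : ℕ∞) :
    seenTypes recordData (l.map (record x)).toFinset v = seenTypes x l.toFinset v := by
  ext τ
  simp only [mem_seenTypes, List.mem_toFinset, List.mem_map, exists_exists_and_eq_and,
    recordData_record]

/-- Improvement depends only on the records involved, so the search can be marked by an operator
that does not depend on the input. -/
theorem markedIndices_improvingRecords (x : Input N) (d' : ℕ) (l : List (Fin N)) :
    markedIndices x (improvingRecords d') (l.map (record x)) = improving x d' l.toFinset := by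
  ext j
  rw [Finset.mem_coe, mem_improving]
  change Improves recordData d' _ (record x j) ↔ _
  rw [Improves, Improves, recordData_record, seenTypes_records]

/-- `I` solves the problem restricted to the indices in `w`, on some black box that is consistent
with the records in `w`. -/
def IsRecordSolution (d' : ℕ) (w : List (Record N)) (I : Finset (Fin N)) : Prop :=
  ∃ x : Input N, (∀ ρ ∈ w, ρ = record x ρ.1) ∧
    IsPartialSolution x d' (w.map Prod.fst).toFinset I

open Classical in
/-- The output of the algorithm: a solution of the problem restricted to the known indices. -/
noncomputable def recordSolution (d' : ℕ) (w : List (Record N)) : Finset (Fin N) :=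
  if h : ∃ I, IsRecordSolution d' w I then h.choose else ∅

/-- The black box behind the chosen output may differ from `x`, but equal records force agreement on
the known indices, and a partial solution depends on nothing else. -/
theorem recordSolution_mem_solutions (x : Input N) (d' : ℕ) (l : List (Fin N))
    (hl : improving x d' l.toFinset = ∅) :
    recordSolution d' (l.map (record x)) ∈ solutions d' x := by
  have hfst : (l.map (record x)).map Prod.fst = l := by
    rw [List.map_map]
    exact List.map_id l
  have hex : ∃ I, IsRecordSolution d' (l.map (record x)) I := by
    obtain ⟨I, hI⟩ := exists_isPartialSolution x d' l.toFinset
    refine ⟨I, x, fun ρ hρ => ?_, by rwa [hfst]⟩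
    obtain ⟨j, -, rfl⟩ := List.mem_map.1 hρ
    rfl
  rw [recordSolution, dif_pos hex]
  obtain ⟨y, hy, hI⟩ := hex.choose_spec
  rw [hfst] at hI
  refine (hI.congr fun j hj => ?_).mem_solutions hl
  have h := hy (record x j) (List.mem_map_of_mem (List.mem_toFinset.1 hj))
  rw [← recordData_record x j, h, recordData_record]
  rfl

end PartialSolutions

/-! ### Sequences of rounds -/

section Evolve

variable {N : ℕ} (P : List (Fin N) → Set (Fin N))

/-- The expectation of `F` after further rounds with numbers `ks` of Grover iterations. -/
noncomputable def evolve : List ℕ → (List (Fin N) → ℝ) → List (Fin N) → ℝ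
  | [], F => F
  | k :: ks, F => roundExpect P k (evolve ks F)

theorem evolve_append (ks ks' : List ℕ) (F : List (Fin N) → ℝ) :
    evolve P (ks ++ ks') F = evolve P ks (evolve P ks' F) := by
  induction ks with
  | nil => rfl
  | cons k ks ih => rw [List.cons_append, evolve, evolve, ih]

theorem evolve_mono (ks : List ℕ) {F G : List (Fin N) → ℝ} (h : ∀ l, F l ≤ G l)
    (l : List (Fin N)) : evolve P ks F l ≤ evolve P ks G l := by
  induction ks generalizing l with
  | nil => exact h l
  | cons k ks ih => exact roundExpect_mono P fun j => ih _

theorem evolve_add_const (hN : 0 < N) (ks : List ℕ) (F : List (Fin N) → ℝ) (c : ℝ)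
    (l : List (Fin N)) : evolve P ks (fun l => F l + c) l = evolve P ks F l + c := by
  induction ks generalizing l with
  | nil => rfl
  | cons k ks ih =>
    have h := roundExpect_const P hN k c l
    simp only [evolve, roundExpect, ih, mul_add, Finset.sum_add_distrib] at h ⊢
    rw [h]

theorem evolve_const_mul (ks : List ℕ) (F : List (Fin N) → ℝ) (c : ℝ) (l : List (Fin N)) :
    evolve P ks (fun l => c * F l) l = c * evolve P ks F l := by
  induction ks generalizing l with
  | nil => rfl
  | cons k ks ih =>
    simp only [evolve, roundExpect, ih, Finset.mul_sum]
    exact Finset.sum_congr rfl fun _ _ => mul_left_comm _ _ _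

theorem evolve_le_one (hN : 0 < N) (ks : List ℕ) {F : List (Fin N) → ℝ} (h : ∀ l, F l ≤ 1)
    (l : List (Fin N)) : evolve P ks F l ≤ 1 := by
  induction ks generalizing l with
  | nil => exact h l
  | cons k ks ih =>
    exact (roundExpect_mono P fun j => ih _).trans (roundExpect_const P hN k 1 l).le

theorem expect_add_length (m : ℕ → ℕ) (ks : List ℕ) (r : ℕ)
    (h : ∀ i (hi : i < ks.length), m (r + i) = ks[i]) (F : List (Fin N) → ℝ) :
    expect P m (r + ks.length) F = expect P m r (evolve P ks F) := by
  induction ks generalizing r with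
  | nil => rfl
  | cons k ks ih =>
    rw [List.length_cons, show r + (ks.length + 1) = r + 1 + ks.length by ring, ih (r + 1),
      expect_succ, evolve]
    · have := h 0 (by simp)
      simp only [add_zero, List.getElem_cons_zero] at this
      rw [this]
    · intro i hi
      have := h (i + 1) (by simpa using hi)
      rw [List.getElem_cons_succ] at this
      rw [← this]
      congr 1
      ring

/-- The number of queries in rounds with numbers `ks` of Grover iterations. -/
def queryCount (ks : List ℕ) : ℕ := (ks.map fun k => 2 * k + 1).sum

theorem queryCount_append (ks ks' : List ℕ) :
    queryCount (ks ++ ks') = queryCount ks + queryCount ks' := by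
  simp [queryCount]

theorem queryCount_replicate (n k : ℕ) :
    queryCount (List.replicate n k) = n * (2 * k + 1) := by
  simp [queryCount]

theorem roundStart_length (m : ℕ → ℕ) (ks : List ℕ)
    (h : ∀ i (hi : i < ks.length), m i = ks[i]) : roundStart m ks.length = queryCount ks := by
  rw [roundStart, queryCount, Finset.sum_range, ← Fin.sum_univ_getElem]
  simp only [List.getElem_map]
  refine Fintype.sum_equiv (finCongr (by simp)) _ _ fun i => ?_
  rw [h i i.2]
  rfl

end Evolve

/-! ### The decrease of the potential -/

section Drift

variable {N : ℕ} (x : Input N) (d' : ℕ)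

/-- The indices that improve on a list of indices. -/
noncomputable def improvingSet (l : List (Fin N)) : Set (Fin N) := improving x d' l.toFinset

/-- The number of indices that improve on a list of indices. -/
noncomputable def improvingCount (l : List (Fin N)) : ℕ := (improving x d' l.toFinset).card

/-- The indicator function of the event that more than `B / 9` indices improve. -/
noncomputable def exceeds (B : ℕ) (l : List (Fin N)) : ℝ :=
  if B < 9 * improvingCount x d' l then 1 else 0

variable {x d'}

theorem toFinset_subset_cons (j : Fin N) (l : List (Fin N)) :
    l.toFinset ⊆ (j :: l).toFinset := by
  rw [List.toFinset_cons]
  exact Finset.subset_insert _ _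

theorem improvingCount_cons_le (j : Fin N) (l : List (Fin N)) :
    improvingCount x d' (j :: l) ≤ improvingCount x d' l :=
  Finset.card_le_card (improving_antitone (toFinset_subset_cons j l))

theorem exceeds_nonneg (B : ℕ) (l : List (Fin N)) : 0 ≤ exceeds x d' B l := by
  unfold exceeds; split_ifs <;> norm_num

theorem exceeds_le_one (B : ℕ) (l : List (Fin N)) : exceeds x d' B l ≤ 1 := by
  unfold exceeds; split_ifs <;> norm_num

theorem exceeds_cons_le (B : ℕ) (j : Fin N) (l : List (Fin N)) :
    exceeds x d' B (j :: l) ≤ exceeds x d' B l := by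
  have := improvingCount_cons_le (x := x) (d' := d') j l
  unfold exceeds
  split_ifs <;> first | omega | norm_num

/-- Each of the `t` improving indices is found with the same probability `p`, where `tp ≥ 1/243`, so
the expected decrease is at least `p * D`. Comparing `D` with `Φ` loses a factor `8b`, and `1944 = 8
* 243`. -/
theorem roundExpect_potential_le (hN : 0 < N) (k b : ℕ) (l : List (Fin N)) (hb : 0 < b)
    (h1 : (2 * k + 1) ^ 2 * improvingCount x d' l ≤ N)
    (h2 : N ≤ 81 * ((2 * k + 1) ^ 2 * improvingCount x d' l))
    (h3 : targetSize d' x ≤ b ∨ improvingCount x d' l ≤ b) :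
    roundExpect (improvingSet x d') k (fun l => potential x d' l.toFinset) l ≤
      (1 - 1 / (1944 * b)) * potential x d' l.toFinset := by
  have hcard : (improvingSet x d' l).ncard = improvingCount x d' l := Set.ncard_coe_finset _
  rw [← hcard] at h1 h2
  obtain ⟨p, hp, hp'⟩ := exists_groverAmp_sq_eq hN (improvingSet x d' l) k h1 h2
  rw [hcard] at hp'
  set S := l.toFinset with hS
  set Φ := potential x d' S with hΦ
  set t : ℝ := (improvingCount x d' l : ℝ) with ht
  set d : ℝ := (targetSize d' x : ℝ) with hd
  set D := ∑ y ∈ improving x d' S, (Φ - potential x d' (insert y S)) with hD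
  have hb' : (0 : ℝ) < b := by exact_mod_cast hb
  have ht0 : 0 ≤ t := by positivity
  have hd0 : 0 ≤ d := by positivity
  have hp0 : 0 < p := by
    by_contra! hneg
    nlinarith
  have hΦ2 : Φ ≤ 2 * d * t := potential_le S
  have hD1 : t ^ 2 / 4 ≤ D := card_sq_le_sum_potential_sub S
  have hD2 : t * d ≤ D := by
    rw [ht, improvingCount, ← nsmul_eq_mul]
    exact Finset.card_nsmul_le_sum _ _ _ fun y hy => targetSize_le_potential_sub hy
  -- From `Φ ≤ 2dt`: use `D ≥ t²/4` if `d ≤ b`, and `D ≥ td` if `t ≤ b`.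
  have hDΦ : t * Φ ≤ 8 * b * D := by
    rcases h3 with h3 | h3
    · have h3' : d ≤ b := by rw [hd]; exact_mod_cast h3
      have hD0 : 0 ≤ D := le_trans (by positivity) hD1
      nlinarith [mul_le_mul_of_nonneg_left hΦ2 ht0, mul_le_mul_of_nonneg_left hD1 hd0,
        mul_le_mul_of_nonneg_right h3' hD0]
    · have h3' : t ≤ b := by rw [ht]; exact_mod_cast h3
      have hD0 : 0 ≤ D := le_trans (by positivity) hD2
      nlinarith [mul_le_mul_of_nonneg_left hΦ2 ht0, mul_le_mul_of_nonneg_left hD2 ht0,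
        mul_le_mul_of_nonneg_right h3' hD0]
  have hΦ0 : 0 ≤ Φ := potential_nonneg S
  have hstep : roundExpect (improvingSet x d') k (fun l => potential x d' l.toFinset) l ≤
      Φ - p * D := by
    have e1 : Φ = ∑ j, groverAmp (improvingSet x d' l) k j ^ 2 * Φ := by
      rw [← Finset.sum_mul, sum_groverAmp_sq hN, one_mul]
    have e2 : roundExpect (improvingSet x d') k (fun l => potential x d' l.toFinset) l =
        ∑ j, groverAmp (improvingSet x d' l) k j ^ 2 * potential x d' (insert j S) := by
      simp only [roundExpect, List.toFinset_cons, ← hS]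
    have e3 : p * D ≤ ∑ j, groverAmp (improvingSet x d' l) k j ^ 2 *
        (Φ - potential x d' (insert j S)) := by
      rw [hD, Finset.mul_sum]
      refine le_trans (Finset.sum_le_sum fun y hy => ?_)
        (Finset.sum_le_sum_of_subset_of_nonneg (Finset.subset_univ (improving x d' S))
          fun y _ _ => mul_nonneg (sq_nonneg _)
            (sub_nonneg.2 (potential_antitone (Finset.subset_insert y S))))
      rw [hp y hy]
    simp only [mul_sub, Finset.sum_sub_distrib] at e3
    rw [← e1, ← e2] at e3
    linarith
  have hfin : 1 / (1944 * b) * Φ ≤ p * D := by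
    rw [div_mul_eq_mul_div, one_mul, div_le_iff₀ (by positivity)]
    have h5 : Φ ≤ 243 * (t * p) * Φ := by nlinarith
    have h6 := mul_le_mul_of_nonneg_left hDΦ hp0.le
    linarith
  linarith

/-- The indicator factor stops the process: it stays zero once `t ≤ B/9`, and until then `B/9 < t ≤
B` makes `k` a suitable number of iterations. The minimum with `N` allows `B > N` in the top stage.
-/
theorem evolve_replicate_le (hN : 0 < N) (k b B : ℕ) (hb : 0 < b)
    (h1 : (2 * k + 1) ^ 2 * min B N ≤ N) (h2 : N ≤ 9 * ((2 * k + 1) ^ 2 * B))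
    (h3 : targetSize d' x ≤ b ∨ B ≤ b) (n : ℕ) (l : List (Fin N))
    (hl : improvingCount x d' l ≤ B) :
    evolve (improvingSet x d') (List.replicate n k)
        (fun l => potential x d' l.toFinset * exceeds x d' B l) l ≤
      (1 - 1 / (1944 * b)) ^ n * (potential x d' l.toFinset * exceeds x d' B l) := by
  have hb' : (1 : ℝ) ≤ b := by exact_mod_cast hb
  have hq : (0 : ℝ) ≤ 1 - 1 / (1944 * b) := by
    rw [sub_nonneg, div_le_one (by positivity)]; linarith
  induction n generalizing l with
  | zero => simp [evolve]
  | succ n ih =>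
    rw [List.replicate_succ, evolve]
    have hstep : roundExpect (improvingSet x d') k
        (fun l => potential x d' l.toFinset * exceeds x d' B l) l ≤
        (1 - 1 / (1944 * b)) * (potential x d' l.toFinset * exceeds x d' B l) := by
      by_cases hB : B < 9 * improvingCount x d' l
      · have hone : exceeds x d' B l = 1 := if_pos hB
        rw [hone, mul_one]
        refine (roundExpect_mono _ fun j => ?_).trans
          (roundExpect_potential_le hN k b l hb ?_ ?_ (h3.imp_right hl.trans))
        · exact mul_le_of_le_one_right (potential_nonneg _) (exceeds_le_one B _)
        · refine le_trans (Nat.mul_le_mul_left _ (le_min hl ?_)) h1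
          exact (Finset.card_le_univ _).trans (Fintype.card_fin N).le
        · refine h2.trans ?_
          nlinarith [Nat.mul_le_mul_left ((2 * k + 1) ^ 2) hB.le]
      · have hzero : exceeds x d' B l = 0 := if_neg hB
        rw [hzero, mul_zero, mul_zero]
        refine Finset.sum_nonpos fun j _ => ?_
        have : exceeds x d' B (j :: l) = 0 :=
          le_antisymm ((exceeds_cons_le B j l).trans hzero.le) (exceeds_nonneg B _)
        simp only [this, mul_zero, le_refl]
    calc _ ≤ roundExpect (improvingSet x d') k (fun l => (1 - 1 / (1944 * b)) ^ n *
            (potential x d' l.toFinset * exceeds x d' B l)) l :=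
          roundExpect_mono _ fun j => ih _ ((improvingCount_cons_le j l).trans hl)
      _ = (1 - 1 / (1944 * b)) ^ n * roundExpect (improvingSet x d') k
            (fun l => potential x d' l.toFinset * exceeds x d' B l) l :=
          evolve_const_mul (improvingSet x d') [k] _ _ l
      _ ≤ _ := by
          rw [pow_succ, mul_assoc]
          exact mul_le_mul_of_nonneg_left hstep (pow_nonneg hq n)

/-- After `n` rounds the number of improving indices has decreased by a factor `9`, with high
probability. -/
theorem evolve_exceeds_le (hN : 0 < N) (k b B : ℕ) (hb : 0 < b) (hB : 0 < B)
    (h1 : (2 * k + 1) ^ 2 * min B N ≤ N) (h2 : N ≤ 9 * ((2 * k + 1) ^ 2 * B))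
    (h3 : targetSize d' x ≤ b ∨ B ≤ b) (hd : 0 < targetSize d' x) (n : ℕ) (hn : 0 < n)
    (l : List (Fin N)) (hl : improvingCount x d' l ≤ B) :
    evolve (improvingSet x d') (List.replicate n k) (exceeds x d' B) l ≤
      34992 * b / n := by
  have hb' : (1 : ℝ) ≤ b := by exact_mod_cast hb
  have hB' : (0 : ℝ) < B := by exact_mod_cast hB
  have hd' : (0 : ℝ) < targetSize d' x := by exact_mod_cast hd
  have hn' : (0 : ℝ) < n := by exact_mod_cast hn
  have hl' : (improvingCount x d' l : ℝ) ≤ B := by exact_mod_cast hl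
  set q : ℝ := 1 / (1944 * b) with hq
  have hq0 : 0 < q := by positivity
  have hq1 : 0 ≤ 1 - q := by
    rw [hq, sub_nonneg, div_le_one (by positivity)]; linarith
  -- The decay is exponential, but a bound inversely proportional to `n` suffices.
  have hpow : (1 - q) ^ n ≤ 1 / (n * q) := by
    have e1 : (1 - q) ^ n ≤ Real.exp (-q) ^ n :=
      pow_le_pow_left₀ hq1 (Real.one_sub_le_exp_neg q) n
    rw [← Real.exp_nat_mul, mul_neg, Real.exp_neg] at e1
    refine e1.trans ?_
    rw [one_div]
    exact inv_anti₀ (by positivity) (by linarith [Real.add_one_le_exp (n * q)])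
  set d : ℝ := (targetSize d' x : ℝ) with hdd
  -- Markov's inequality: more than `B/9` improving indices force a potential above `dB/9`. With the
  -- initial bound `2dB` the constant becomes `9 * 2 * 1944 = 34992`.
  have hpt : ∀ l, exceeds x d' B l ≤
      9 / (d * B) * (potential x d' l.toFinset * exceeds x d' B l) := by
    intro l
    by_cases h : B < 9 * improvingCount x d' l
    · have hone : exceeds x d' B l = 1 := if_pos h
      rw [hone, mul_one, div_mul_eq_mul_div, le_div_iff₀ (by positivity), one_mul]
      have h4 : d * (improvingCount x d' l : ℝ) ≤ potential x d' l.toFinset :=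
        targetSize_mul_card_le_potential _
      have h5 : (B : ℝ) ≤ 9 * improvingCount x d' l := by exact_mod_cast h.le
      nlinarith
    · have hzero : exceeds x d' B l = 0 := if_neg h
      rw [hzero, mul_zero, mul_zero]
  have hΦ : potential x d' l.toFinset * exceeds x d' B l ≤ 2 * d * B := by
    have h4 : potential x d' l.toFinset ≤ 2 * d * improvingCount x d' l := potential_le _
    have h5 := exceeds_le_one (x := x) (d' := d') B l
    have h6 : 2 * d * (improvingCount x d' l : ℝ) ≤ 2 * d * B :=
      mul_le_mul_of_nonneg_left hl' (by positivity)
    exact (mul_le_of_le_one_right (potential_nonneg _) h5).trans (h4.trans h6)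
  calc _ ≤ _ := evolve_mono _ _ hpt l
    _ = 9 / (d * B) * _ := evolve_const_mul _ _ _ _ _
    _ ≤ 9 / (d * B) * ((1 - q) ^ n * (potential x d' l.toFinset * exceeds x d' B l)) :=
      mul_le_mul_of_nonneg_left (evolve_replicate_le hN k b B hb h1 h2 h3 n l hl) (by positivity)
    _ ≤ 9 / (d * B) * ((1 / (n * q)) * (2 * d * B)) :=
      mul_le_mul_of_nonneg_left (mul_le_mul hpow hΦ
        (mul_nonneg (potential_nonneg _) (exceeds_nonneg _ _)) (by positivity)) (by positivity)
    _ = 34992 * b / n := by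
      rw [hq]; field_simp; norm_num

end Drift

/-! ### The schedule -/

section Schedule

/-- The distance of `j` and `p`. -/
def gap (j p : ℕ) : ℕ := (j - p) + (p - j)

theorem sum_pow_gap_le {q : ℝ} (h0 : 0 ≤ q) (h1 : q < 1) (n p : ℕ) :
    ∑ j ∈ Finset.range n, q ^ gap j p ≤ 2 / (1 - q) := by
  have hgeom : ∀ n, ∑ j ∈ Finset.range n, q ^ j ≤ 1 / (1 - q) := fun n => by
    rw [one_div]
    exact (summable_geometric_of_lt_one h0 h1).sum_le_tsum _ (fun _ _ => pow_nonneg h0 _) |>.trans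
      (tsum_geometric_of_lt_one h0 h1).le
  have key : ∀ p n, ∑ j ∈ Finset.range n, q ^ gap j p ≤
      1 / (1 - q) + ∑ s ∈ Finset.range p, q ^ (s + 1) := by
    intro p
    induction p with
    | zero => intro n; simpa [gap] using hgeom n
    | succ p ih =>
      intro n
      rw [Finset.sum_range_succ]
      cases n with
      | zero =>
        have : (0 : ℝ) < 1 - q := by linarith
        simp only [Finset.range_zero, Finset.sum_empty]
        positivity
      | succ n =>
        rw [Finset.sum_range_succ']
        have e : ∀ j, gap (j + 1) (p + 1) = gap j p := fun j => by simp [gap]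
        simp only [e]
        have e' : gap 0 (p + 1) = p + 1 := by simp [gap]
        rw [e']
        linarith [ih n]
  refine (key p n).trans ?_
  have h2 : ∑ s ∈ Finset.range p, q ^ (s + 1) ≤ 1 / (1 - q) := by
    refine (Finset.sum_le_sum fun s _ => ?_).trans (hgeom p)
    exact pow_le_pow_of_le_one h0 h1.le (Nat.le_succ s)
  rw [show (2 : ℝ) / (1 - q) = 1 / (1 - q) + 1 / (1 - q) by ring]
  linarith

/-- Stage `j` of run `p`: the number of improving indices decreases from `9 ^ j` to below
`9 ^ j / 9`, if `9 ^ p` is large enough. Each round makes `3 ^ (J - j - 1)` queries. -/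
def stage (A J p j : ℕ) : List ℕ :=
  List.replicate (A * 9 ^ min j p * 2 ^ gap j p) ((3 ^ (J - j - 1) - 1) / 2)

/-- The stages `j, j - 1, …, 0` of run `p`. -/
def stages (A J p : ℕ) : ℕ → List ℕ
  | 0 => stage A J p 0
  | j + 1 => stage A J p (j + 1) ++ stages A J p j

/-- The runs `0, …, p - 1`. -/
def runs (A J : ℕ) : ℕ → List ℕ
  | 0 => []
  | p + 1 => runs A J p ++ stages A J p J

/-- The number of Grover iterations in round `r`. -/
def schedule (A J r : ℕ) : ℕ := (runs A J (r + 1)).getD r 0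

/-- Powers of 3 are odd, hence possible lengths of a round; this is why the scales are powers of 9.
-/
theorem two_mul_half_pow_three (i : ℕ) : 2 * ((3 ^ i - 1) / 2) + 1 = 3 ^ i := by
  obtain ⟨c, hc⟩ : Odd (3 ^ i) := Odd.pow (by decide)
  omega

/-- Since `2 min(j, p) - j + |j - p| = p`, the basic cost of the stage is at most `3^(J+p) /
3^|j-p|`; the extra repetitions multiply it by `2^|j-p|`. -/
theorem queryCount_stage_le (A J p j : ℕ) (hj : j ≤ J) :
    (queryCount (stage A J p j) : ℝ) ≤ A * 3 ^ (J + p) * (2 / 3) ^ gap j p := by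
  have h1 : 9 ^ min j p * 3 ^ (J - j) * 3 ^ gap j p = 3 ^ (J + p) := by
    rw [show 9 = 3 ^ 2 by norm_num, ← pow_mul, ← pow_add, ← pow_add]
    congr 1
    unfold gap
    omega
  have h1' : (9 : ℝ) ^ min j p * 3 ^ (J - j) * 3 ^ gap j p = 3 ^ (J + p) := by exact_mod_cast h1
  have h2 : (3 : ℝ) ^ (J - j - 1) ≤ 3 ^ (J - j) :=
    pow_le_pow_right₀ (by norm_num) (Nat.sub_le _ _)
  rw [stage, queryCount_replicate, two_mul_half_pow_three]
  push_cast
  rw [div_pow, ← h1']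
  calc (A : ℝ) * 9 ^ min j p * 2 ^ gap j p * 3 ^ (J - j - 1)
      ≤ A * 9 ^ min j p * 2 ^ gap j p * 3 ^ (J - j) :=
        mul_le_mul_of_nonneg_left h2 (by positivity)
    _ = _ := by field_simp

theorem queryCount_stages_le (A J p j : ℕ) (hj : j ≤ J) :
    (queryCount (stages A J p j) : ℝ) ≤
      A * 3 ^ (J + p) * ∑ i ∈ Finset.range (j + 1), (2 / 3) ^ gap i p := by
  induction j with
  | zero => simpa [stages] using queryCount_stage_le A J p 0 hj
  | succ j ih =>
    rw [stages, queryCount_append, Finset.sum_range_succ, mul_add, add_comm, Nat.cast_add]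
    have := queryCount_stage_le A J p (j + 1) hj
    have := ih (Nat.le_of_succ_le hj)
    linarith

/-- Run `p` costs at most `6A * 3^(J+p)`, where `6 = 2 / (1 - 2/3)`; the induction closes because `3
+ 6 = 3 * 3`. -/
theorem queryCount_runs_le (A J p : ℕ) :
    (queryCount (runs A J p) : ℝ) ≤ 3 * A * 3 ^ (J + p) := by
  induction p with
  | zero => simp only [runs, queryCount, List.map_nil, List.sum_nil, Nat.cast_zero]; positivity
  | succ p ih =>
    rw [runs, queryCount_append, Nat.cast_add]
    have h1 := queryCount_stages_le A J p J le_rfl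
    have h2 := sum_pow_gap_le (q := 2 / 3) (by norm_num) (by norm_num) (J + 1) p
    have h3 := mul_le_mul_of_nonneg_left h2 (by positivity : (0 : ℝ) ≤ A * 3 ^ (J + p))
    norm_num at h3
    rw [← add_assoc, pow_succ]
    linarith

/-- Every run has at least one round, so the default value in `schedule` is never reached. -/
theorem length_runs (A J p : ℕ) (hA : 0 < A) : p ≤ (runs A J p).length := by
  induction p with
  | zero => simp
  | succ p ih =>
    have h0 : 0 < (stage A J p 0).length := by simp [stage, hA]
    have h1 : 0 < (stages A J p J).length := by
      have : ∀ j, 0 < (stages A J p j).length := by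
        intro j
        induction j with
        | zero => exact h0
        | succ j ih => rw [stages, List.length_append]; omega
      exact this J
    rw [runs, List.length_append]
    omega

theorem runs_prefix (A J : ℕ) {p q : ℕ} (h : p ≤ q) : runs A J p <+: runs A J q := by
  induction h with
  | refl => exact List.prefix_rfl
  | step _ ih => exact ih.trans (List.prefix_append _ _)

theorem schedule_eq (A J p : ℕ) (hA : 0 < A) (i : ℕ) (hi : i < (runs A J p).length) :
    schedule A J i = (runs A J p)[i] := by
  have hi' : i < (runs A J (i + 1)).length := length_runs A J (i + 1) hA
  rw [schedule, List.getD_eq_getElem _ _ hi']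
  rcases le_total p (i + 1) with h | h
  · exact ((runs_prefix A J h).getElem hi).symm
  · exact (runs_prefix A J h).getElem hi'

variable {N : ℕ} {x : Input N} {d' : ℕ}

theorem evolve_stage_le (hN : 0 < N) {A J p j : ℕ} (hA : 0 < A) (hJ : N ≤ 9 ^ J)
    (hJ' : 0 < J → 9 ^ (J - 1) ≤ N) (hj : j ≤ J) (hd : 0 < targetSize d' x)
    (hp : targetSize d' x ≤ 9 ^ p) (l : List (Fin N)) (hl : improvingCount x d' l ≤ 9 ^ j) :
    evolve (improvingSet x d') (stage A J p j) (exceeds x d' (9 ^ j)) l ≤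
      34992 / A * (1 / 2) ^ gap j p := by
  have hL : (3 ^ (J - j - 1)) ^ 2 * 9 ^ j = 9 ^ (J - j - 1 + j) := by
    rw [← pow_mul, mul_comm _ 2, pow_mul, pow_add]
    norm_num
  have h := evolve_exceeds_le (x := x) (d' := d') hN ((3 ^ (J - j - 1) - 1) / 2)
    (9 ^ min j p) (9 ^ j) (by positivity) (by positivity) ?_ ?_ ?_ hd
    (A * 9 ^ min j p * 2 ^ gap j p) (by positivity) l hl
  · refine h.trans (le_of_eq ?_)
    have : (A : ℝ) ≠ 0 := by exact_mod_cast hA.ne'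
    push_cast
    rw [div_pow, one_pow]
    field_simp
  · rw [two_mul_half_pow_three]
    -- For `j = J` the truncated exponent is 0: the round is a single query of a uniformly random
    -- index.
    rcases hj.eq_or_lt with rfl | hlt
    · simp
    · refine (Nat.mul_le_mul_left _ (min_le_left _ _)).trans ?_
      rw [hL, show J - j - 1 + j = J - 1 by omega]
      exact hJ' (by omega)
  · rw [two_mul_half_pow_three, hL, ← pow_succ']
    exact hJ.trans (Nat.pow_le_pow_right (by norm_num) (by omega))
  · rcases le_total j p with h | h
    · right; rw [min_eq_left h]
    · left; rwa [min_eq_right h]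

theorem evolve_stages_le (hN : 0 < N) {A J p : ℕ} (hA : 0 < A) (hJ : N ≤ 9 ^ J)
    (hJ' : 0 < J → 9 ^ (J - 1) ≤ N) (hd : 0 < targetSize d' x)
    (hp : targetSize d' x ≤ 9 ^ p) (j : ℕ) (hj : j ≤ J) (l : List (Fin N))
    (hl : improvingCount x d' l ≤ 9 ^ j) :
    evolve (improvingSet x d') (stages A J p j) (exceeds x d' 1) l ≤
      34992 / A * ∑ i ∈ Finset.range (j + 1), (1 / 2) ^ gap i p := by
  induction j generalizing l with
  | zero => simpa [stages] using evolve_stage_le hN hA hJ hJ' hj hd hp l hl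
  | succ j ih =>
    have ih := ih (Nat.le_of_succ_le hj)
    set c := 34992 / (A : ℝ) * ∑ i ∈ Finset.range (j + 1), (1 / 2) ^ gap i p with hc
    have hc0 : 0 ≤ c := by positivity
    rw [stages, evolve_append, Finset.sum_range_succ, mul_add, ← hc]
    -- Union bound: either stage `j + 1` fails, or the lower stages start within their range and
    -- fail with probability at most `c`.
    have h1 : ∀ l, evolve (improvingSet x d') (stages A J p j) (exceeds x d' 1) l ≤
        exceeds x d' (9 ^ (j + 1)) l + c := by
      intro l
      by_cases h : 9 ^ (j + 1) < 9 * improvingCount x d' l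
      · have hone : exceeds x d' (9 ^ (j + 1)) l = 1 := if_pos h
        rw [hone]
        have := evolve_le_one (improvingSet x d') hN (stages A J p j)
          (exceeds_le_one (x := x) (d' := d') 1) l
        linarith
      · have hzero : exceeds x d' (9 ^ (j + 1)) l = 0 := if_neg h
        rw [hzero, zero_add]
        refine ih l ?_
        rw [pow_succ] at h
        omega
    refine (evolve_mono _ _ h1 l).trans ?_
    rw [evolve_add_const _ hN, add_comm]
    have := evolve_stage_le hN hA hJ hJ' hj hd hp l hl
    linarith

/-- Run `p` finds a solution with high probability, if `9 ^ p` is large enough. -/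
theorem expect_exceeds_le (hN : 0 < N) {A J p : ℕ} (hA : 0 < A) (hJ : N ≤ 9 ^ J)
    (hJ' : 0 < J → 9 ^ (J - 1) ≤ N) (hd : 0 < targetSize d' x)
    (hp : targetSize d' x ≤ 9 ^ p) :
    expect (improvingSet x d') (schedule A J) (runs A J (p + 1)).length (exceeds x d' 1) ≤
      139968 / A := by
  rw [runs, List.length_append, expect_add_length]
  · refine le_trans ?_ (expect_const (improvingSet x d') (schedule A J) hN
      (runs A J p).length _).le
    -- The bound holds from every list, so the outcome of earlier runs is irrelevant. The constant
    -- is `4 * 34992`.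
    refine expect_mono _ _ fun l => ?_
    refine (evolve_stages_le hN hA hJ hJ' hd hp J le_rfl l ?_).trans ?_
    · exact ((Finset.card_le_univ _).trans (Fintype.card_fin N).le).trans hJ
    · have := mul_le_mul_of_nonneg_left (sum_pow_gap_le (q := 1 / 2) (by norm_num) (by norm_num)
        (J + 1) p) (by positivity : (0 : ℝ) ≤ 34992 / A)
      refine this.trans (le_of_eq ?_)
      ring
  · intro i hi
    rw [schedule_eq A J (p + 1) hA _ (by rw [runs, List.length_append]; omega)]
    simp [runs]

theorem roundStart_runs_le {A J p : ℕ} (hA : 0 < A) :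
    (roundStart (schedule A J) (runs A J p).length : ℝ) ≤ 3 * A * 3 ^ (J + p) := by
  rw [roundStart_length _ _ fun i hi => schedule_eq A J p hA i hi]
  exact queryCount_runs_le A J p

/-- New records never create improving indices, whatever the number of iterations in the additional
rounds. -/
theorem expect_exceeds_antitone (m : ℕ → ℕ) (hN : 0 < N) {r s : ℕ} (h : r ≤ s) :
    expect (improvingSet x d') m s (exceeds x d' 1) ≤
      expect (improvingSet x d') m r (exceeds x d' 1) := by
  induction h with
  | refl => exact le_rfl
  | step _ ih =>
    refine le_trans ?_ ih
    rw [expect_succ]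
    refine expect_mono _ _ fun l => ?_
    refine (roundExpect_mono (G := fun _ => exceeds x d' 1 l) _ fun j =>
      exceeds_cons_le 1 j l).trans ?_
    exact (roundExpect_const (improvingSet x d') hN _ (exceeds x d' 1 l) l).le

end Schedule

/-! ### The main theorem -/

section Main

variable {N : ℕ}

theorem one_sub_expect_le_outputProb (hN : 0 < N) (j₀ : Fin N) (m : ℕ → ℕ) (d' : ℕ)
    (x : Input N) (T : ℕ) :
    1 - expect (improvingSet x d') m (clock m T).1 (exceeds x d' 1) ≤
      (searchAlgorithm j₀ m (improvingRecords d') (recordSolution d')).outputProb x T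
        (solutions d' x) := by
  refine le_trans ?_ (expect_le_outputProb m hN j₀ x (improvingRecords d') (recordSolution d') T
    (solutions d' x))
  simp only [markedIndices_improvingRecords]
  change _ ≤ expect (improvingSet x d') m _ _
  rw [sub_le_iff_le_add, ← expect_const (improvingSet x d') m hN (clock m T).1 1]
  simp only [expect, ← Finset.sum_add_distrib, ← mul_add]
  refine Finset.sum_le_sum fun l _ => mul_le_mul_of_nonneg_left ?_ (sq_nonneg _)
  by_cases h : improving x d' l.toFinset = ∅
  · rw [Set.indicator_of_mem (by exact recordSolution_mem_solutions x d' l h), Pi.one_apply]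
    linarith [exceeds_nonneg (x := x) (d' := d') 1 l]
  · have hpos : 0 < improvingCount x d' l := Finset.card_pos.2 (Finset.nonempty_iff_ne_empty.2 h)
    have hone : exceeds x d' 1 l = 1 := if_pos (by omega)
    rw [hone]
    have : (0 : ℝ) ≤ Set.indicator {l : List (Fin N) |
      recordSolution d' (l.map (record x)) ∈ solutions d' x} 1 l :=
        Set.indicator_nonneg (fun _ _ => zero_le_one) l
    linarith

theorem pow_clog_le (n : ℕ) (hn : 0 < n) : (3 : ℝ) ^ Nat.clog 9 n ≤ 3 * √n := by
  rcases Nat.eq_or_lt_of_le (Nat.succ_le_of_lt hn) with h | h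
  · rw [← h]; norm_num
  · have h1 := Nat.pow_pred_clog_lt_self (b := 9) (by norm_num) h
    have h2 : 0 < Nat.clog 9 n := Nat.clog_pos (by norm_num) h
    rw [← Nat.sub_one] at h1
    have h3 : ((3 : ℝ) ^ (Nat.clog 9 n - 1)) ^ 2 ≤ n := by
      rw [← pow_mul, mul_comm, pow_mul]
      norm_num
      exact_mod_cast h1.le
    have h4 := Real.le_sqrt_of_sq_le h3
    calc (3 : ℝ) ^ Nat.clog 9 n = 3 * 3 ^ (Nat.clog 9 n - 1) := by
          rw [← pow_succ', Nat.sub_add_cancel h2]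
      _ ≤ _ := by linarith

/-- One algorithm finds the smallest values of different type with bounded error. -/
theorem exists_algorithm (ε : ℝ) (hε : 0 < ε) : ∃ C : ℝ, 0 < C ∧ ∀ N : ℕ, 0 < N → ∀ d' : ℕ,
    ∃ A : QueryAlgorithm N (Finset (Fin N)), ∀ x : Input N, ∀ T : ℕ,
      C * √((targetSize d' x : ℝ) * (N : ℝ)) ≤ (T : ℝ) →
        1 - ε ≤ A.outputProb x T (solutions d' x) := by
  obtain ⟨A, hA⟩ := exists_nat_gt (139968 / ε)
  have hA0 : (0 : ℝ) < A := lt_trans (by positivity) hA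
  have hA0' : 0 < A := by exact_mod_cast hA0
  -- The runs up to `p` cost at most `3A * 3^(J+p+1)`, and rounding `N` and `d` up to powers of 9
  -- gives `3^(J+p+1) ≤ 27 √(dN)`.
  refine ⟨81 * A, by positivity, fun N hN d' => ?_⟩
  set J := Nat.clog 9 N with hJdef
  have hJ : N ≤ 9 ^ J := Nat.le_pow_clog (by norm_num) N
  have hJ' : 0 < J → 9 ^ (J - 1) ≤ N := by
    intro hJ0
    have hN1 : 1 < N := by
      by_contra! h
      have : N = 1 := by omega
      simp [hJdef, this] at hJ0
    exact (Nat.pow_pred_clog_lt_self (by norm_num) hN1).le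
  refine ⟨searchAlgorithm ⟨0, hN⟩ (schedule A J) (improvingRecords d') (recordSolution d'),
    fun x T hT => le_trans ?_ (one_sub_expect_le_outputProb hN _ _ d' x T)⟩
  suffices h : expect (improvingSet x d') (schedule A J) (clock (schedule A J) T).1
      (exceeds x d' 1) ≤ ε by linarith
  -- For `d = 0` no index ever improves, so even `T = 0` is enough.
  rcases Nat.eq_zero_or_pos (targetSize d' x) with hd | hd
  · refine le_trans (expect_mono _ _ (G := fun _ => 0) fun l => ?_) ?_
    · have : improving x d' l.toFinset = ∅ := by
        refine Finset.eq_empty_of_forall_notMem fun j hj => ?_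
        have := card_seenTypes_lt hj
        omega
      have h0 : improvingCount x d' l = 0 := by rw [improvingCount, this, Finset.card_empty]
      rw [exceeds, h0]
      simp
    · rw [expect_const _ _ hN]; exact hε.le
  · set p := Nat.clog 9 (targetSize d' x) with hp
    have hr : roundStart (schedule A J) (runs A J (p + 1)).length ≤ T := by
      have h1 := roundStart_runs_le (A := A) (J := J) (p := p + 1) hA0'
      have h2 : (3 : ℝ) ^ (J + (p + 1)) ≤ 27 * √((targetSize d' x : ℝ) * N) := by
        rw [Real.sqrt_mul (Nat.cast_nonneg _), ← add_assoc, pow_succ, pow_add]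
        have h3 := mul_le_mul (pow_clog_le N hN) (pow_clog_le _ hd) (by positivity) (by positivity)
        rw [← hJdef, ← hp] at h3
        linarith
      have h4 := mul_le_mul_of_nonneg_left h2 (by positivity : (0 : ℝ) ≤ 3 * A)
      have h5 : (roundStart (schedule A J) (runs A J (p + 1)).length : ℝ) ≤ T := by linarith
      exact_mod_cast h5
    refine (expect_exceeds_antitone (schedule A J) hN (le_clock _ hr)).trans ?_
    refine (expect_exceeds_le hN hA0' hJ hJ' hd (Nat.le_pow_clog (by norm_num) _)).trans ?_
    rw [div_le_iff₀ hA0]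
    rw [div_lt_iff₀ hε] at hA
    linarith

/-- Rounding `C √(dN)` up to an integer costs less than 1, hence at most `√(dN)` if `d ≥ 1`; for `d
= 0` there is nothing to round. -/
theorem queryComplexity_solutions_le {ε C : ℝ} (hC : 0 < C) (hN : 0 < N) (d' d : ℕ)
    (A : QueryAlgorithm N (Finset (Fin N)))
    (hA : ∀ x : Input N, ∀ T : ℕ, C * √((targetSize d' x : ℝ) * (N : ℝ)) ≤ (T : ℝ) →
      1 - ε ≤ A.outputProb x T (solutions d' x)) :
    ((queryComplexity ε {x : Input N | targetSize d' x = d} (solutions d') : ℕ∞) : ENNReal) ≤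
      ENNReal.ofReal ((C + 1) * √((d : ℝ) * (N : ℝ))) := by
  set T := ⌈C * √((d : ℝ) * (N : ℝ))⌉₊ with hT
  have h1 : queryComplexity ε {x : Input N | targetSize d' x = d} (solutions d') ≤ (T : ℕ∞) := by
    refine iInf₂_le T ⟨A, fun x hx => hA x T ?_⟩
    rw [show targetSize d' x = d from hx]
    exact Nat.le_ceil _
  have h2 : (T : ℝ) ≤ (C + 1) * √((d : ℝ) * (N : ℝ)) := by
    rcases Nat.eq_zero_or_pos d with rfl | hd
    · simp [hT]
    · have h3 : (1 : ℝ) ≤ √((d : ℝ) * (N : ℝ)) := by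
        rw [Real.one_le_sqrt]
        exact_mod_cast Nat.mul_pos hd hN
      have h4 := (Nat.ceil_lt_add_one (show 0 ≤ C * √((d : ℝ) * (N : ℝ)) by positivity)).le
      rw [← hT] at h4
      linarith
  calc ((queryComplexity ε {x : Input N | targetSize d' x = d} (solutions d') : ℕ∞) : ENNReal)
      ≤ ((T : ℕ∞) : ENNReal) := ENat.toENNReal_le.2 h1
    _ = ENNReal.ofReal (T : ℝ) := by rw [ENat.toENNReal_coe, ENNReal.ofReal_natCast]
    _ ≤ _ := ENNReal.ofReal_le_ofReal h2

/-- Under injectivity an element of `I` with the type of `j` would be `j` itself, so the exchange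
condition for `j ∉ I` just forbids `f j < f i`. -/
theorem isSmallestValuesDifferentTypes_iff_of_injective {d : ℕ} (f : Fin N → ℕ∞)
    (g : Fin N → ℕ) (hd : d ≤ N) (hg : Function.Injective g) (I : Finset (Fin N)) :
    IsSmallestValuesDifferentTypes f g d I ↔ IsSmallestValues f d I := by
  have he : min d (numTypes g) = d := by
    rw [numTypes, Finset.card_image_of_injective _ hg, Finset.card_univ, Fintype.card_fin,
      min_eq_left hd]
  rw [IsSmallestValuesDifferentTypes, IsSmallestValues, he]
  refine and_congr_right fun _ => ⟨fun h j hj i hi => ?_, fun h => ⟨fun i _ i' _ hne heq =>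
    hne (hg heq), fun j hj i hi hlt => absurd (h j hj i hi) (not_le.2 hlt)⟩⟩
  by_contra! hlt
  obtain ⟨i', hi', hgi, -⟩ := h.2 j hj i hi hlt
  exact hj (hg hgi ▸ hi')

theorem isSmallestValuesDifferentTypes_const_iff (d' : ℕ) (g : Fin N → ℕ) (c : ℕ∞)
    (I : Finset (Fin N)) :
    IsSmallestValuesDifferentTypes (fun _ => c) g d' I ↔ IsDifferentTypes g d' I := by
  simp [IsSmallestValuesDifferentTypes, IsDifferentTypes]

end Main

end QuantumMinima

theorem mainTheorem1 :
    -- query complexity: `O(√(dN))` on the instances with `min {d', e} = d`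
    (∀ ε : ℝ, 0 < ε → ∃ C : ℝ, 0 < C ∧ ∀ N : ℕ, 0 < N → ∀ d' d : ℕ,
      ((QuantumMinima.queryComplexity ε
          {x : QuantumMinima.Input N | QuantumMinima.targetSize d' x = d}
          (QuantumMinima.solutions d') : ℕ∞) : ENNReal)
        ≤ ENNReal.ofReal (C * √((d : ℝ) * (N : ℝ)))) ∧
    -- moreover one algorithm, which is given only `N` and `d'`, does this for all `d` at once
    (∀ ε : ℝ, 0 < ε → ∃ C : ℝ, 0 < C ∧ ∀ N : ℕ, 0 < N → ∀ d' : ℕ,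
      ∃ A : QuantumMinima.QueryAlgorithm N (Finset (Fin N)),
        ∀ x : QuantumMinima.Input N, ∀ T : ℕ,
          C * √((QuantumMinima.targetSize d' x : ℝ) * (N : ℝ)) ≤ (T : ℝ) →
          1 - ε ≤ A.outputProb x T (QuantumMinima.solutions d' x)) ∧
    -- the `d` smallest values of `f`: the special case of pairwise different types
    (∀ (N d : ℕ) (f : Fin N → ℕ∞) (g : Fin N → ℕ), d ≤ N → Function.Injective g →
      ∀ I : Finset (Fin N),
        QuantumMinima.IsSmallestValuesDifferentTypes f g d I ↔
          QuantumMinima.IsSmallestValues f d I) ∧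
    -- `d` elements of different type: the special case of constant `f`
    (∀ (N d' : ℕ) (g : Fin N → ℕ) (c : ℕ∞) (I : Finset (Fin N)),
        QuantumMinima.IsSmallestValuesDifferentTypes (fun _ => c) g d' I ↔
          QuantumMinima.IsDifferentTypes g d' I) := by
  refine ⟨fun ε hε => ?_, QuantumMinima.exists_algorithm,
    fun N d f g hd hg I =>
      QuantumMinima.isSmallestValuesDifferentTypes_iff_of_injective f g hd hg I,
    fun N d' g c I => QuantumMinima.isSmallestValuesDifferentTypes_const_iff d' g c I⟩
  obtain ⟨C, hC, h⟩ := QuantumMinima.exists_algorithm ε hε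
  refine ⟨C + 1, by positivity, fun N hN d' d => ?_⟩
  obtain ⟨A, hA⟩ := h N hN d'
  exact QuantumMinima.queryComplexity_solutions_le hC hN d' d A hA
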